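/- Let $\mathbb X$ be a real Hilbert space (of any dimension) and equip the Hilbert sum $\mathbb T=\mathbb X\oplus\mathbb X$ with $\Omega(x_1\oplus x_2)=(-x_2)\oplus x_1$ and the symplectic form $\omega(x,y)=\langle x,\Omega y\rangle$. Let $\mathcal{LG}(\mathbb T)$ be the set of Lagrangian (i.e. maximal isotropic) subspaces of $\mathbb T$, embedded in the bounded operators on $\mathbb T$ by sending a subspace to its orthogonal projection. For complementary closed subspaces $\mathbb A,\mathbb B$ let $[\mathbb A\mathbb B]$ be the operator equal to $1$ on $\mathbb A$ and $-1$ on $\mathbb B$. Let $\mathbb U\subset\mathbb R$ be a nonempty open interval. A curve $\mathbb K:\mathbb U\to\mathcal{LG}(\mathbb T)$ is *regular* if it is smooth and, for each $u\in\mathbb U$, $\mathbb K(u+s)$ and $\mathbb K(u)$ are complementary for all small $s\neq 0$ and $s[\mathbb K(u+s)\mathbb K(u)]$ converges in operator norm as $s\to0$ (in particular this holds if $\mathbb K$ is smooth, has pairwise complementary values and has a tangent covector at each point). It is *positive* if the quadratic form $x\mapsto\lim_{s\to0}\omega(s[\mathbb K(u)\mathbb K(u+s)]x,x)$ is positive semidefinite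 for each $u\in\mathbb U$. A *potential* is a smooth family $p(u)$, $u\in\mathbb U$, of bounded self-adjoint operators on $\mathbb X$. For a potential $p$, let $\mathbb J(p)$ be the space of smooth solutions $J:\mathbb U\to\mathbb X$ of $\ddot J+pJ=0$, with the topology and the symplectic form obtained from $\mathbb T$ by $J\mapsto J(u)\oplus\dot J(u)$ (both independent of $u\in\mathbb U$). The *Hamiltonian curve* of $p$ is $\mathbb H_p(u)=\{J\in\mathbb J(p): J(u)=0\}$. A canonical transformation is a linear homeomorphism preserving the symplectic forms. A *positive hyperbolic structure* $(\mathcal J,\mathcal K)$ on $\mathbb T$ consists of bounded operators with $\mathcal J^2=-1$, $\mathcal K^2=1$, $\mathcal J\mathcal K+\mathcal K\mathcal J=0$, $\omega(\mathcal Jx,\mathcal Jy)=\omega(x,y)$, $\omega(\mathcal Kx,\mathcal Ky)=-\omega(x,y)$ and $\omega(\mathcal Jx,x)>0$ for $x\ne0$; put $\mathbb K_\pm=\ker(1\mp\mathcal K)$, with the inner product $\omega(\mathcal Jx,y)$. Let $V\subseteq\mathbb U$ be an open interval on which $\mathbb K(u)$ is complementary to $\mathbb K_-$, and write $\mathbb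 K(u)=\{a+\mathcal JH(u)a: a\in\mathbb K_+\}$ with $H(u)$ a bounded operator on $\mathbb K_+$. A *Lagrange--Schwarzian* of $\mathbb K$ on $V$ relative to $(\mathcal J,\mathcal K)$ is a family of operators on $\mathbb K_+$ of the form $$\mathcal S=\tfrac12X^*\bigl(2\dddot H-3\ddot H\dot H^{-1}\ddot H\bigr)X,\qquad \dot X=-\tfrac12\dot H^{-1}\ddot HX,\qquad XX^*=\dot H^{-1},$$ with $X(u)$ an invertible operator on $\mathbb K_+$ for each $u\in V$, where $*$ is the adjoint for the inner product $\omega(\mathcal Jx,y)$. **Theorem.** Let $\mathbb K$ be a regular positive curve in $\mathcal{LG}(\mathbb X\oplus\mathbb X)$ defined on $\mathbb U$. Then there exist a potential $p$ on $\mathbb U$ and a canonical transformation $\phi_0:\mathbb J(p)\to\mathbb X\oplus\mathbb X$ such that $\phi_0\mathbb H_p(u)=\mathbb K(u)$ for all $u\in\mathbb U$. Moreover $p$ is half the Lagrange--Schwarzian of $\mathbb K$: for every positive hyperbolic structure $(\mathcal J,\mathcal K)$ and every open interval $V\subseteq\mathbb U$ on which $\mathbb K(u)$ is complementary to $\mathbb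 K_-$, a Lagrange--Schwarzian of $\mathbb K$ on $V$ relative to $(\mathcal J,\mathcal K)$ exists, and for each such $\mathcal S$ there is an isometric isomorphism $T$ of $\mathbb X$ onto $\mathbb K_+$ with the inner product $\omega(\mathcal Jx,y)$, independent of $u$, with $p(u)=\tfrac12T^{-1}\mathcal S(u)T$ for all $u\in V$. -/

import Mathlib

open scoped ContDiff Topology InnerProductSpace
open Filter TopologicalSpace

noncomputable section

namespace LagrangianCurves

variable {X : Type*} [NormedAddCommGroup X] [InnerProductSpace ℝ X]

/-- The Hilbert sum of two copies of `X`. -/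
abbrev Dbl (X : Type*) [NormedAddCommGroup X] [InnerProductSpace ℝ X] : Type _ :=
  WithLp 2 (X × X)

/-- The standard symplectic form `ω(x, y) = ⟪x, Ω y⟫` on `X ⊕ X`, where
`Ω (y₁ ⊕ y₂) = (-y₂) ⊕ y₁`. -/
def omega (x y : Dbl X) : ℝ :=
  ⟪x, WithLp.toLp 2 (-y.snd, y.fst)⟫_ℝ

/-- The subspace `L` is isotropic. -/
def IsIsotropic (L : Submodule ℝ (Dbl X)) : Prop :=
  ∀ x ∈ L, ∀ y ∈ L, omega x y = 0

/-- Lagrangian subspaces are the maximal isotropic ones. -/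
def IsLagrangian (L : Submodule ℝ (Dbl X)) : Prop :=
  Maximal IsIsotropic L

/-- `R` is the reflection `[AB]` of two complementary subspaces: the identity on `A` and minus the
identity on `B`. -/
structure IsReflection (A B : Submodule ℝ (Dbl X)) (R : Dbl X →L[ℝ] Dbl X) : Prop where
  isCompl : IsCompl A B
  left : ∀ a ∈ A, R a = a
  right : ∀ b ∈ B, R b = -b

/-- `N` is the tangent covector of `K` at `u`: for small `s ≠ 0` the subspaces `K (u + s)` and `K u`
are complementary, and `[K(u+s) K(u)] = 2 s⁻¹ N + o(s⁻¹)` in operator norm as `s → 0`. -/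
def HasTangentCovector (K : ℝ → Submodule ℝ (Dbl X)) (u : ℝ) (N : Dbl X →L[ℝ] Dbl X) : Prop :=
  ∃ R : ℝ → Dbl X →L[ℝ] Dbl X,
    (∀ᶠ s in 𝓝[≠] (0 : ℝ), IsReflection (K (u + s)) (K u) (R s)) ∧
    Tendsto (fun s : ℝ => s • R s) (𝓝[≠] 0) (𝓝 ((2 : ℝ) • N))

/-- A positive hyperbolic structure `(J, R)` on `X ⊕ X`: a symplectic complex structure `J` and an
anticommuting antisymplectic reflection `R` such that the form `(x, y) ↦ ω(J x, y)` is positive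
definite. -/
structure IsPositiveHyperbolic (J R : Dbl X →L[ℝ] Dbl X) : Prop where
  symplectic : ∀ x y, omega (J x) (J y) = omega x y
  antisymplectic : ∀ x y, omega (R x) (R y) = -omega x y
  sq_left : ∀ x, J (J x) = -x
  sq_right : ∀ x, R (R x) = x
  anticomm : ∀ x, J (R x) + R (J x) = 0
  pos : ∀ x, x ≠ 0 → 0 < omega (J x) x

/-- The `+1` eigenspace of a reflection. -/
def plusSpace (R : Dbl X →L[ℝ] Dbl X) : Submodule ℝ (Dbl X) where
  carrier := {x | R x = x}
  add_mem' := by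
    intro a b ha hb
    simp only [Set.mem_ofPred_eq] at ha hb ⊢
    rw [map_add, ha, hb]
  zero_mem' := by simp
  smul_mem' := by
    intro c a ha
    simp only [Set.mem_ofPred_eq] at ha ⊢
    rw [map_smul, ha]

/-- The `-1` eigenspace of a reflection. -/
def minusSpace (R : Dbl X →L[ℝ] Dbl X) : Submodule ℝ (Dbl X) where
  carrier := {x | R x = -x}
  add_mem' := by
    intro a b ha hb
    simp only [Set.mem_ofPred_eq] at ha hb ⊢
    rw [map_add, ha, hb, neg_add]
  zero_mem' := by simp
  smul_mem' := by
    intro c a ha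
    simp only [Set.mem_ofPred_eq] at ha ⊢
    rw [map_smul, ha, smul_neg]

/-- `S` is a Lagrange-Schwarzian of the curve `K` on `V` in the gauge `(J, R)`. The operator `J`
identifies the `+1` eigenspace of `R` with its `-1` eigenspace, so that `K u` is the graph of `J ∘ H u`
for an operator `H u` of the `+1` eigenspace. `Y u` is the adjoint of `A u` for the inner product
`(x, y) ↦ ω(J x, y)`. Then `A u` is invertible, `A' = -(1/2) H'⁻¹ H'' A`, `A A* = H'⁻¹`,
`S = (1/2) A* (2 H''' - 3 H'' H'⁻¹ H'') A`. -/
def IsLagrangeSchwarzian (J R : Dbl X →L[ℝ] Dbl X) (V : Opens ℝ) (K : ℝ → Submodule ℝ (Dbl X))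
    (S : ℝ → plusSpace R →L[ℝ] plusSpace R) : Prop :=
  ∃ H A Y : ℝ → plusSpace R →L[ℝ] plusSpace R,
    ContDiffOn ℝ ∞ H V ∧
    ∀ u ∈ V,
      (∀ z : Dbl X, z ∈ K u ↔ ∃ a : plusSpace R, z = (a : Dbl X) + J (H u a)) ∧
      IsUnit (deriv H u) ∧
      IsUnit (A u) ∧
      (∀ a b : plusSpace R, omega (J (A u a)) b = omega (J a) (Y u b)) ∧
      HasDerivAt A
        (-(2⁻¹ : ℝ) • (Ring.inverse (deriv H u) * iteratedDeriv 2 H u * A u)) u ∧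
      A u * Y u = Ring.inverse (deriv H u) ∧
      S u = (2⁻¹ : ℝ) • (Y u *
        ((2 : ℝ) • iteratedDeriv 3 H u -
          (3 : ℝ) • (iteratedDeriv 2 H u * Ring.inverse (deriv H u) * iteratedDeriv 2 H u)) * A u)

/-- The space of smooth solutions `f : U → X` of `f'' + p f = 0` on the open set `U`. A function on
`U` is represented by its extension by zero. -/
def solutionSpace (U : Opens ℝ) (p : ℝ → X →L[ℝ] X) : Submodule ℝ (ℝ → X) where
  carrier := {f | ContDiffOn ℝ ∞ f U ∧ (∀ u ∈ U, deriv (deriv f) u + p u (f u) = 0) ∧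
    ∀ u ∉ U, f u = 0}
  add_mem' := by
    rintro f g ⟨hf, hf', hf0⟩ ⟨hg, hg', hg0⟩
    refine ⟨hf.add hg, fun u hu => ?_, fun u hu => by simp [hf0 u hu, hg0 u hu]⟩
    have hn : (U : Set ℝ) ∈ 𝓝 u := U.isOpen.mem_nhds hu
    have h1 : deriv (f + g) =ᶠ[𝓝 u] deriv f + deriv g := by
      filter_upwards [hn] with v hv
      have hv' := U.isOpen.mem_nhds hv
      exact deriv_add ((hf.contDiffAt hv').differentiableAt (by simp))
        ((hg.contDiffAt hv').differentiableAt (by simp))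
    have hdf := ((hf.deriv_of_isOpen U.isOpen (m := ∞) (by simp)).contDiffAt hn).differentiableAt
      (by simp)
    have hdg := ((hg.deriv_of_isOpen U.isOpen (m := ∞) (by simp)).contDiffAt hn).differentiableAt
      (by simp)
    rw [h1.deriv_eq, deriv_add hdf hdg, Pi.add_apply, map_add]
    have := congrArg₂ (· + ·) (hf' u hu) (hg' u hu)
    simp only [add_zero] at this
    rw [← this]
    abel
  zero_mem' := by
    refine ⟨contDiffOn_const, fun u _ => ?_, fun _ _ => rfl⟩
    have h : deriv (0 : ℝ → X) = 0 := by
      funext v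
      exact deriv_const v 0
    rw [h, h]
    simp
  smul_mem' := by
    rintro c f ⟨hf, hf', hf0⟩
    refine ⟨hf.const_smul c, fun u hu => ?_, fun u hu => by simp [hf0 u hu]⟩
    have hn : (U : Set ℝ) ∈ 𝓝 u := U.isOpen.mem_nhds hu
    have h1 : deriv (c • f) =ᶠ[𝓝 u] c • deriv f := by
      filter_upwards [hn] with v hv
      have hv' := U.isOpen.mem_nhds hv
      exact deriv_const_smul c ((hf.contDiffAt hv').differentiableAt (by simp))
    have hdf := ((hf.deriv_of_isOpen U.isOpen (m := ∞) (by simp)).contDiffAt hn).differentiableAt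
      (by simp)
    rw [h1.deriv_eq, deriv_const_smul c hdf, Pi.smul_apply, map_smul, ← smul_add, hf' u hu,
      smul_zero]

/-- The Cauchy data `f(u) ⊕ f'(u)` of a solution. -/
def cauchyData {U : Opens ℝ} {p : ℝ → X →L[ℝ] X} (u : ℝ) (f : solutionSpace U p) : Dbl X :=
  WithLp.toLp 2 (f.1 u, deriv f.1 u)

/-- The Hamiltonian curve of `p`: at `u`, the space of the solutions that vanish at `u`. -/
def hamiltonianCurve (U : Opens ℝ) (p : ℝ → X →L[ℝ] X) (u : ℝ) :
    Submodule ℝ (solutionSpace U p) where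
  carrier := {f | f.1 u = 0}
  add_mem' := by
    intro f g hf hg
    simp only [Set.mem_ofPred_eq] at hf hg ⊢
    simp [hf, hg]
  zero_mem' := by simp
  smul_mem' := by
    intro c f hf
    simp only [Set.mem_ofPred_eq] at hf ⊢
    simp [hf]

/-- The linear isomorphism `φ` from the solution space onto `X ⊕ X` is a canonical transformation.
The topology and the symplectic form of the solution space are those transported from `X ⊕ X` by
taking Cauchy data at a point `u` of `U`; they do not depend on `u`. So `φ` is required to be
bicontinuous in the Cauchy data, and to preserve the symplectic form, at every `u`. -/
def IsCanonicalTransformation {U : Opens ℝ} {p : ℝ → X →L[ℝ] X}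
    (φ : solutionSpace U p ≃ₗ[ℝ] Dbl X) : Prop :=
  ∀ u ∈ U,
    (∃ M : Dbl X ≃L[ℝ] Dbl X, ∀ f, φ f = M (cauchyData u f)) ∧
    ∀ f g, omega (φ f) (φ g) = omega (cauchyData u f) (cauchyData u g)

section Complete

variable [CompleteSpace X]

/-- A smooth curve in the Lagrangian Grassmannian of `X ⊕ X`, which is embedded in the bounded
operators by sending a subspace to the orthogonal projection onto it. -/
def IsSmoothLagrangianCurve (U : Opens ℝ) (K : ℝ → Submodule ℝ (Dbl X)) : Prop :=
  (∀ u ∈ U, IsLagrangian (K u)) ∧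
  ∃ P : ℝ → Dbl X →L[ℝ] Dbl X, ContDiffOn ℝ ∞ P U ∧
    ∀ u ∈ U, IsStarProjection (P u) ∧ (P u).range = K u

/-- A regular curve: smooth, with a tangent covector at every point. The existence of the tangent
covector includes that `K (u + s)` and `K u` are complementary for all small `s ≠ 0`; it is not
required that `K s` and `K t` be complementary for all distinct `s` and `t`. -/
def IsRegularCurve (U : Opens ℝ) (K : ℝ → Submodule ℝ (Dbl X)) : Prop :=
  IsSmoothLagrangianCurve U K ∧ ∀ u ∈ U, ∃ N, HasTangentCovector K u N

/-- The curve is positive: the quadratic form `x ↦ lim ω(s [K(u) K(u+s)] x, x)`, `s → 0`, is positive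
semidefinite for every `u`. -/
def IsPositiveCurve (U : Opens ℝ) (K : ℝ → Submodule ℝ (Dbl X)) : Prop :=
  ∀ u ∈ U, ∃ R : ℝ → Dbl X →L[ℝ] Dbl X,
    (∀ᶠ s in 𝓝[≠] (0 : ℝ), IsReflection (K u) (K (u + s)) (R s)) ∧
    ∀ x, ∃ l : ℝ, 0 ≤ l ∧ Tendsto (fun s : ℝ => omega (s • R s x) x) (𝓝[≠] 0) (𝓝 l)

/-- A potential on `U`: a smooth family of bounded self-adjoint operators of `X`. -/
def IsPotential (U : Opens ℝ) (p : ℝ → X →L[ℝ] X) : Prop :=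
  ContDiffOn ℝ ∞ p U ∧ ∀ u ∈ U, IsSelfAdjoint (p u)

/-- `p` is half the Lagrange-Schwarzian of `K` in every gauge: for every positive hyperbolic structure
`(J, R)` and every open subinterval `V` of `U` on which `K` is complementary to the `-1` eigenspace of
`R`, a Lagrange-Schwarzian `S` exists, and for every such `S` there is a unitary identification `T` of
`X` with the `+1` eigenspace of `R`, with its inner product `ω(J x, y)`, that carries `p` to `S / 2`. -/
def IsHalfSchwarzian (U : Opens ℝ) (K : ℝ → Submodule ℝ (Dbl X)) (p : ℝ → X →L[ℝ] X) : Prop :=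
  ∀ J R : Dbl X →L[ℝ] Dbl X, IsPositiveHyperbolic J R →
  ∀ V : Opens ℝ, V ≤ U → (V : Set ℝ).OrdConnected →
    (∀ u ∈ V, IsCompl (K u) (minusSpace R)) →
    (∃ S, IsLagrangeSchwarzian J R V K S) ∧
    ∀ S, IsLagrangeSchwarzian J R V K S →
      ∃ T : X ≃L[ℝ] plusSpace R,
        (∀ x y : X, omega (J (T x)) (T y) = ⟪x, y⟫_ℝ) ∧
        ∀ u ∈ V, ∀ x : X, T (p u x) = (2⁻¹ : ℝ) • S u (T x)

end Complete

end LagrangianCurves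

end

/-! The curve is studied through moving frames: smooth families of injective operators W(u) from X
with range K(u). A frame is normal when ω(W a, W' b) = -⟨a, b⟩ and W'' = -W p, and such a frame
solves the problem. Differentiating the pairing gives ω(W', W') = 0, so W and W' form a symplectic
basis of X ⊕ X at each u. Hence J ↦ -W' J + W J' does not depend on u when J'' + p J = 0, preserves
the symplectic forms, and sends the solutions vanishing at u onto W(u) X = K(u)
(`exists_canonicalTransformation`).

Existence (`exists_isNormalFrame`): parallel transport gives an isometric frame F. The form D =
-ω(F, F') is symmetric because K(u) is isotropic, nonnegative because the curve is positive, and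
invertible because the tangent covector N kills K(u) and satisfies N F' = F. For W = F C, the
condition ω(W, W'') = 0 is the linear equation 2 D C' + E C = 0 with E = -ω(F, F''). It preserves C*
D C, so C* D C = 1 need only be arranged at one point. Since K(u) is its own symplectic complement,
W'' then takes values in K(u), that is, W'' = -W p; differentiating ω(W', W') = 0 makes p symmetric.

Schwarzian: in the splitting of X ⊕ X given by a hyperbolic structure, a normal frame has components
A and H A with A'' = -A q and (H A)'' = -H A q. Together these give the gauge equation for A, and
the normalization gives A A* = H'⁻¹ (`exists_schwarzian_gauge`); conversely, any such gauge gives a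
normal frame with q = S/2 (`exists_isNormalFrame_of_schwarzian`). Two normal frames of one curve
differ by a constant isometry (`IsNormalFrame.exists_equiv`), which conjugates p to S/2.

In infinite dimension X must still be identified isometrically with K(v) and with the `+1`
eigenspace, of which only the doubles are known to be homeomorphic to X ⊕ X. This is a comparison of
Hilbert dimensions (`nonempty_linearIsometryEquiv_of_double`). -/

noncomputable section

namespace LagrangianCurves

/-! ### Global solutions of linear differential equations -/

section LinearODE

variable {E : Type*} [NormedAddCommGroup E] [NormedSpace ℝ E]

/-- The terms of the Dyson series of the linear equation `y' = Φ y`, `y u₀ = y₀`. -/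
def dysonTerm (Φ : ℝ → E →L[ℝ] E) (u₀ : ℝ) (y₀ : E) : ℕ → ℝ → E
  | 0 => fun _ => y₀
  | n + 1 => fun u => ∫ t in u₀..u, Φ t (dysonTerm Φ u₀ y₀ n t)

/-- An open order-connected set contains a compact interval around any two of its points. -/
theorem exists_Icc_subset {U : Set ℝ} (hU : IsOpen U) (hc : U.OrdConnected) {u v : ℝ}
    (hu : u ∈ U) (hv : v ∈ U) :
    ∃ a b : ℝ, u ∈ Set.Ioo a b ∧ v ∈ Set.Ioo a b ∧ Set.Icc a b ⊆ U := by
  have key : ∀ w ∈ U, ∃ a b : ℝ, a < w ∧ w < b ∧ a ∈ U ∧ b ∈ U := by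
    intro w hw
    obtain ⟨ε, hε, h⟩ := Metric.isOpen_iff.1 hU w hw
    refine ⟨w - ε / 2, w + ε / 2, by linarith, by linarith, h ?_, h ?_⟩ <;>
      simp [abs_of_pos hε, hε]
  obtain ⟨a, b, h1, h2, ha, hb⟩ := key u hu
  obtain ⟨a', b', h1', h2', ha', hb'⟩ := key v hv
  refine ⟨min a a', max b b', ⟨by simp [h1], by simp [h2]⟩, ⟨by simp [h1'], by simp [h2']⟩,
    hc.out ?_ ?_⟩
  · rcases min_choice a a' with h | h <;> rw [h] <;> assumption
  · rcases max_choice b b' with h | h <;> rw [h] <;> assumption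

/-- Each integration turns |t - u₀|ⁿ into |u - u₀|ⁿ⁺¹/(n + 1). The resulting factorial makes the
series converge on any compact interval, however large Φ is there, so solutions are global. -/
theorem norm_dysonTerm_le {Φ : ℝ → E →L[ℝ] E} {u₀ a b m : ℝ} (y₀ : E)
    (hu₀ : u₀ ∈ Set.Icc a b) (hm : ∀ t ∈ Set.Icc a b, ‖Φ t‖ ≤ m) (n : ℕ) :
    ∀ u ∈ Set.Icc a b, ‖dysonTerm Φ u₀ y₀ n u‖ ≤ m ^ n * |u - u₀| ^ n / n.factorial * ‖y₀‖ := by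
  have hm0 : 0 ≤ m := (norm_nonneg _).trans (hm u₀ hu₀)
  induction n with
  | zero => intro u _; simp [dysonTerm]
  | succ n ih =>
    intro u hu
    have hsub : Set.uIoc u₀ u ⊆ Set.Icc a b :=
      Set.uIoc_subset_uIcc.trans (Set.uIcc_subset_Icc hu₀ hu)
    calc ‖dysonTerm Φ u₀ y₀ (n + 1) u‖
        ≤ ∫ t in Set.uIoc u₀ u, m ^ (n + 1) / n.factorial * ‖y₀‖ * |t - u₀| ^ n := by
          simp only [dysonTerm]
          rw [intervalIntegral.norm_intervalIntegral_eq]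
          refine MeasureTheory.norm_integral_le_of_norm_le
            (Continuous.integrableOn_uIoc (by fun_prop)) ?_
          refine (MeasureTheory.ae_restrict_mem measurableSet_uIoc).mono fun t ht => ?_
          calc ‖Φ t (dysonTerm Φ u₀ y₀ n t)‖ ≤ ‖Φ t‖ * ‖dysonTerm Φ u₀ y₀ n t‖ := (Φ t).le_opNorm _
            _ ≤ m * (m ^ n * |t - u₀| ^ n / n.factorial * ‖y₀‖) := by
                gcongr
                · exact hm t (hsub ht)
                · exact ih t (hsub ht)
            _ = _ := by ring
      _ = m ^ (n + 1) * |u - u₀| ^ (n + 1) / (n + 1).factorial * ‖y₀‖ := by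
          rw [MeasureTheory.integral_const_mul, integral_pow_abs_sub_uIoc, Nat.factorial_succ]
          push_cast
          field_simp

variable [CompleteSpace E]

/-- The two claims feed each other: continuity of one term lets the fundamental theorem of calculus
differentiate the next, which is therefore continuous. -/
theorem dysonTerm_continuousOn_and_hasDerivAt {Φ : ℝ → E →L[ℝ] E} {U : Set ℝ} (hU : IsOpen U)
    (hc : U.OrdConnected) (hΦ : ContinuousOn Φ U) {u₀ : ℝ} (hu₀ : u₀ ∈ U) (y₀ : E) (n : ℕ) :
    ContinuousOn (dysonTerm Φ u₀ y₀ n) U ∧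
      ∀ u ∈ U, HasDerivAt (dysonTerm Φ u₀ y₀ (n + 1)) (Φ u (dysonTerm Φ u₀ y₀ n u)) u := by
  have step : ∀ n, ContinuousOn (dysonTerm Φ u₀ y₀ n) U →
      ∀ u ∈ U, HasDerivAt (dysonTerm Φ u₀ y₀ (n + 1)) (Φ u (dysonTerm Φ u₀ y₀ n u)) u := by
    intro n h u hu
    have hcont : ContinuousOn (fun t => Φ t (dysonTerm Φ u₀ y₀ n t)) U := hΦ.clm_apply h
    refine intervalIntegral.integral_hasDerivAt_right
      (hcont.mono (hc.uIcc_subset hu₀ hu)).intervalIntegrable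
      (hcont.stronglyMeasurableAtFilter hU u hu) (hcont.continuousAt (hU.mem_nhds hu))
  induction n with
  | zero => exact ⟨continuousOn_const, step 0 continuousOn_const⟩
  | succ n ih =>
    have h : ContinuousOn (dysonTerm Φ u₀ y₀ (n + 1)) U := fun u hu =>
      (ih.2 u hu).continuousAt.continuousWithinAt
    exact ⟨h, step _ h⟩

omit [CompleteSpace E] in
theorem dysonTerm_succ_self {Φ : ℝ → E →L[ℝ] E} (u₀ : ℝ) (y₀ : E) (n : ℕ) :
    dysonTerm Φ u₀ y₀ (n + 1) u₀ = 0 := by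
  simp [dysonTerm]

/-- A linear differential equation with continuous coefficients has a global solution. -/
theorem exists_hasDerivAt_linear {Φ : ℝ → E →L[ℝ] E} {U : Set ℝ} (hU : IsOpen U)
    (hc : U.OrdConnected) (hΦ : ContinuousOn Φ U) {u₀ : ℝ} (hu₀ : u₀ ∈ U) (y₀ : E) :
    ∃ y : ℝ → E, y u₀ = y₀ ∧ ∀ u ∈ U, HasDerivAt y (Φ u (y u)) u := by
  have hd := dysonTerm_continuousOn_and_hasDerivAt hU hc hΦ hu₀ y₀
  refine ⟨fun u => ∑' n, dysonTerm Φ u₀ y₀ n u, ?_, fun u hu => ?_⟩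
  · change ∑' n, dysonTerm Φ u₀ y₀ n u₀ = y₀
    rw [tsum_eq_single 0]
    · rfl
    · intro n hn
      obtain ⟨k, rfl⟩ := Nat.exists_eq_succ_of_ne_zero hn
      exact dysonTerm_succ_self _ _ _
  obtain ⟨a, b, hau, ha0, hab⟩ := exists_Icc_subset hU hc hu hu₀
  obtain ⟨m, hm⟩ := isCompact_Icc.exists_bound_of_continuousOn (hΦ.mono hab)
  have hm0 : 0 ≤ m := (norm_nonneg _).trans (hm u₀ ⟨ha0.1.le, ha0.2.le⟩)
  have hbd : ∀ n, ∀ v ∈ Set.Icc a b,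
      ‖dysonTerm Φ u₀ y₀ n v‖ ≤ (m * (b - a)) ^ n / n.factorial * ‖y₀‖ := by
    intro n v hv
    refine (norm_dysonTerm_le y₀ ⟨ha0.1.le, ha0.2.le⟩ hm n v hv).trans ?_
    rw [mul_pow]
    gcongr
    rw [abs_le]
    constructor <;> linarith [hv.1, hv.2, ha0.1, ha0.2]
  have hs : Summable fun n : ℕ => (m * (b - a)) ^ n / n.factorial * ‖y₀‖ :=
    (Real.summable_pow_div_factorial _).mul_right _
  have hsum : ∀ v ∈ Set.Icc a b, Summable fun n => dysonTerm Φ u₀ y₀ n v := fun v hv =>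
    Summable.of_norm_bounded hs fun n => hbd n v hv
  -- Only the terms of positive index are differentiated; their derivatives are Φ applied to all the
  -- terms, so they sum to Φ y.
  have hder := hasDerivAt_tsum_of_isPreconnected (u := fun n : ℕ => m * ((m * (b - a)) ^ n / n.factorial * ‖y₀‖))
    (g := fun n => dysonTerm Φ u₀ y₀ (n + 1)) (g' := fun n v => Φ v (dysonTerm Φ u₀ y₀ n v))
    (hs.mul_left m) isOpen_Ioo isPreconnected_Ioo
    (fun n v hv => (hd n).2 v (hab ⟨hv.1.le, hv.2.le⟩))
    (fun n v hv => ((Φ v).le_opNorm _).trans (mul_le_mul (hm v ⟨hv.1.le, hv.2.le⟩)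
      (hbd n v ⟨hv.1.le, hv.2.le⟩) (norm_nonneg _) hm0))
    ha0 (by simpa only [dysonTerm_succ_self] using summable_zero) hau
  have hsu := hsum u ⟨hau.1.le, hau.2.le⟩
  rw [(Φ u).map_tsum hsu]
  refine (hder.const_add y₀).congr_of_eventuallyEq ?_
  filter_upwards [Ioo_mem_nhds hau.1 hau.2] with v hv
  exact (hsum v ⟨hv.1.le, hv.2.le⟩).tsum_eq_zero_add

/-- Bootstrapping: if y is of class Cⁿ, so is y' = Φ y. -/
theorem contDiffOn_of_hasDerivAt_linear {E : Type*} [NormedAddCommGroup E] [NormedSpace ℝ E]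
    {Φ : ℝ → E →L[ℝ] E} {U : Set ℝ} (hU : IsOpen U)
    (hΦ : ContDiffOn ℝ ∞ Φ U) {y : ℝ → E} (hy : ∀ u ∈ U, HasDerivAt y (Φ u (y u)) u) :
    ContDiffOn ℝ ∞ y U := by
  rw [contDiffOn_infty]
  intro n
  induction n with
  | zero =>
    rw [Nat.cast_zero, contDiffOn_zero]
    exact fun u hu => (hy u hu).continuousAt.continuousWithinAt
  | succ n ih =>
    rw [Nat.cast_succ, contDiffOn_succ_iff_deriv_of_isOpen hU]
    refine ⟨fun u hu => (hy u hu).differentiableAt.differentiableWithinAt, by simp, ?_⟩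
    exact ((hΦ.of_le (by exact_mod_cast le_top)).clm_apply ih).congr fun u hu => (hy u hu).deriv

end LinearODE

/-! ### Linear flows in a Banach algebra -/

section Algebra

variable {A : Type*} [NormedRing A] [NormedAlgebra ℝ A]

theorem eq_of_hasDerivAt_zero {E : Type*} [NormedAddCommGroup E] [NormedSpace ℝ E] {U : Set ℝ}
    (hU : IsOpen U) (hc : U.OrdConnected) {f : ℝ → E} (hf : ∀ u ∈ U, HasDerivAt f 0 u) {u v : ℝ}
    (hu : u ∈ U) (hv : v ∈ U) : f u = f v :=
  hU.is_const_of_deriv_eq_zero hc.isPreconnected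
    (fun w hw => (hf w hw).differentiableAt.differentiableWithinAt)
    (fun w hw => (hf w hw).deriv) hu hv

variable [CompleteSpace A]

omit [NormedAlgebra ℝ A] in
/-- A continuous left inverse on a connected set is a right inverse if it is one at a point. -/
theorem mul_eq_one_of_left_inverse {U : Set ℝ} (hc : U.OrdConnected)
    {G L : ℝ → A} (hG : ContinuousOn G U) (hL : ContinuousOn L U) (h : ∀ u ∈ U, L u * G u = 1)
    {u₀ : ℝ} (hu₀ : u₀ ∈ U) (h₀ : G u₀ * L u₀ = 1) : ∀ u ∈ U, G u * L u = 1 := by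
  have : PreconnectedSpace U := Subtype.preconnectedSpace hc.isPreconnected
  have hcl : IsClopen {u : U | G u * L u = 1} := by
    have hG' : Continuous fun u : U => G u := continuousOn_iff_continuous_domRestrict.1 hG
    have hL' : Continuous fun u : U => L u := continuousOn_iff_continuous_domRestrict.1 hL
    refine ⟨isClosed_eq (hG'.mul hL') continuous_const, ?_⟩
    -- Given the left inverse, being a right inverse at u is the same as G u being a unit, an open
    -- condition.
    have : {u : U | G u * L u = 1} = (fun u : U => G u) ⁻¹' {x | IsUnit x} := by
      ext u
      simp only [Set.mem_ofPred_eq, Set.mem_preimage]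
      constructor
      · intro hu
        exact ⟨⟨G u, L u, hu, h u u.2⟩, rfl⟩
      · rintro ⟨g, hg⟩
        have h1 := h u u.2
        rw [← hg] at h1 ⊢
        rw [(Units.mul_eq_one_iff_eq_inv).1 h1]
        simp
    rw [this]
    exact Units.isOpen.preimage hG'
  intro u hu
  have := hcl.eq_univ ⟨⟨u₀, hu₀⟩, h₀⟩
  exact (this ▸ Set.mem_univ (⟨u, hu⟩ : U) : (⟨u, hu⟩ : U) ∈ {u : U | G u * L u = 1})

/-- The solution of `G' = M G` with invertible initial value, in a Banach algebra. -/
theorem exists_linear_flow {M : ℝ → A} {U : Set ℝ} (hU : IsOpen U)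
    (hc : U.OrdConnected) (hM : ContDiffOn ℝ ∞ M U) {u₀ : ℝ} (hu₀ : u₀ ∈ U) (g₀ : Aˣ) :
    ∃ G L : ℝ → A, ContDiffOn ℝ ∞ G U ∧ ContDiffOn ℝ ∞ L U ∧ G u₀ = g₀ ∧
      ∀ u ∈ U, HasDerivAt G (M u * G u) u ∧ HasDerivAt L (-(L u * M u)) u ∧
        L u * G u = 1 ∧ G u * L u = 1 := by
  have h1 : ContDiffOn ℝ ∞ (fun u => ContinuousLinearMap.mul ℝ A (M u)) U :=
    (ContinuousLinearMap.mul ℝ A).contDiff.comp_contDiffOn hM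
  have h2 : ContDiffOn ℝ ∞ (fun u => (ContinuousLinearMap.mul ℝ A).flip (-M u)) U :=
    (ContinuousLinearMap.mul ℝ A).flip.contDiff.comp_contDiffOn hM.neg
  obtain ⟨G, hG0, hG⟩ := exists_hasDerivAt_linear hU hc h1.continuousOn hu₀ (g₀ : A)
  obtain ⟨L, hL0, hL⟩ := exists_hasDerivAt_linear hU hc h2.continuousOn hu₀ (↑g₀⁻¹ : A)
  have hGs := contDiffOn_of_hasDerivAt_linear hU h1 hG
  have hLs := contDiffOn_of_hasDerivAt_linear hU h2 hL
  simp only [ContinuousLinearMap.mul_apply', ContinuousLinearMap.flip_apply, mul_neg] at hG hL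
  have hLG : ∀ u ∈ U, L u * G u = 1 := by
    intro u hu
    have := eq_of_hasDerivAt_zero hU hc (f := fun u => L u * G u) (fun v hv => by
      have := (hL v hv).mul (hG v hv)
      rwa [show -(L v * M v) * G v + L v * (M v * G v) = 0 by noncomm_ring] at this) hu hu₀
    simpa [hG0, hL0] using this
  -- The derivative of G L is the commutator of M with G L, which is not visibly zero; connectedness
  -- replaces a uniqueness argument.
  have hGL := mul_eq_one_of_left_inverse hc hGs.continuousOn hLs.continuousOn hLG hu₀
    (by simp [hG0, hL0])
  exact ⟨G, L, hGs, hLs, hG0, fun u hu => ⟨hG u hu, hL u hu, hLG u hu, hGL u hu⟩⟩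

end Algebra

/-- A copy of the vector space `F`, to carry another norm. -/
def FormSpace (F : Type*) : Type _ := F

instance [AddCommGroup F] : AddCommGroup (FormSpace F) := inferInstanceAs (AddCommGroup F)

instance [AddCommGroup F] [Module ℝ F] : Module ℝ (FormSpace F) := inferInstanceAs (Module ℝ F)

/-! ### Hilbert dimension and equivalent inner products -/

section HilbertDimension

universe u

variable {E F : Type u} [NormedAddCommGroup E] [InnerProductSpace ℝ E]
  [NormedAddCommGroup F] [InnerProductSpace ℝ F]

open Cardinal in
/-- A Hilbert space onto which `E × E` maps continuously has no larger Hilbert dimension than `E`, if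
that is infinite. -/
theorem mk_hilbertBasis_le {ι κ : Type u} [Infinite ι] (b : HilbertBasis ι ℝ E)
    (c : HilbertBasis κ ℝ F) (M : E × E →L[ℝ] F) (hM : Function.Surjective M) : #κ ≤ #ι := by
  let v : ι ⊕ ι → F := Sum.elim (fun i => M (b i, 0)) (fun i => M (0, b i))
  -- A basis vector orthogonal to every v j would be orthogonal to the whole range of M, hence to
  -- itself.
  have h : ∀ k, ∃ j, ⟪v j, c k⟫_ℝ ≠ 0 := by
    intro k
    by_contra! hk
    have aux : ∀ N : E →L[ℝ] F, (∀ i, ⟪N (b i), c k⟫_ℝ = 0) → ∀ x, ⟪N x, c k⟫_ℝ = 0 := by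
      intro N hN x
      have hz : (innerSL ℝ (c k)).comp N = 0 := by
        refine ContinuousLinearMap.ext_on (s := Set.range b) ?_ ?_
        · rw [Submodule.dense_iff_topologicalClosure_eq_top]
          exact b.dense_span
        · rintro _ ⟨i, rfl⟩
          simpa [real_inner_comm] using hN i
      have := DFunLike.congr_fun hz x
      simpa [real_inner_comm] using this
    have h1 := aux (M.comp (ContinuousLinearMap.inl ℝ E E)) fun i => by simpa [v] using hk (.inl i)
    have h2 := aux (M.comp (ContinuousLinearMap.inr ℝ E E)) fun i => by simpa [v] using hk (.inr i)
    obtain ⟨⟨x, y⟩, hxy⟩ := hM (c k)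
    have h3 : ⟪c k, c k⟫_ℝ = 0 := by
      have e : M (x, y) = M (x, 0) + M (0, y) := by rw [← map_add]; simp
      have h1x := h1 x
      have h2y := h2 y
      simp only [ContinuousLinearMap.coe_comp, Function.comp_apply,
        ContinuousLinearMap.inl_apply, ContinuousLinearMap.inr_apply] at h1x h2y
      nth_rewrite 1 [← hxy]
      rw [e, inner_add_left, h1x, h2y, add_zero]
    have h4 := c.orthonormal.1 k
    rw [inner_self_eq_zero] at h3
    simp [h3] at h4
  choose f hf using h
  -- A vector has only countably many nonzero coefficients in a Hilbert basis, so f is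
  -- countable-to-one and #κ ≤ (#ι + #ι) · ℵ₀ = #ι.
  have hfib : ∀ j, #(f ⁻¹' {j}) ≤ ℵ₀ := by
    intro j
    rw [Cardinal.le_aleph0_iff_set_countable]
    refine (c.summable_inner_mul_inner (v j) (v j)).countable_support.mono ?_
    rintro k rfl
    have := hf k
    simp only [Function.mem_support, ne_eq, mul_eq_zero, not_or]
    exact ⟨this, by rwa [real_inner_comm]⟩
  have := mk_le_mk_mul_of_mk_preimage_le f hfib
  have hι : ℵ₀ ≤ #ι := Cardinal.aleph0_le_mk ι
  simpa [Cardinal.mk_sum, Cardinal.add_eq_self hι, Cardinal.mul_aleph0_eq hι] using this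

theorem HilbertBasis.finiteDimensional {ι : Type u} [Finite ι] (b : HilbertBasis ι ℝ E) :
    FiniteDimensional ℝ E := by
  have := Fintype.ofFinite ι
  exact b.toOrthonormalBasis.toBasis.finiteDimensional_of_finite

/-- Hilbert spaces with homeomorphic doubles are isometric. -/
theorem nonempty_linearIsometryEquiv_of_double [CompleteSpace E] [CompleteSpace F]
    (e : (E × E) ≃L[ℝ] (F × F)) : Nonempty (E ≃ₗᵢ[ℝ] F) := by
  by_cases hE : FiniteDimensional ℝ E
  · have hF : FiniteDimensional ℝ F := by
      have : FiniteDimensional ℝ (F × F) := e.toLinearEquiv.finiteDimensional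
      exact Module.Finite.of_injective (LinearMap.inl ℝ F F) LinearMap.inl_injective
    have h := e.toLinearEquiv.finrank_eq
    rw [Module.finrank_prod, Module.finrank_prod] at h
    exact ⟨(stdOrthonormalBasis ℝ E).equiv (stdOrthonormalBasis ℝ F) (finCongr (by omega))⟩
  · have hF : ¬ FiniteDimensional ℝ F := by
      intro hF
      have : FiniteDimensional ℝ (E × E) := e.symm.toLinearEquiv.finiteDimensional
      exact hE (Module.Finite.of_injective (LinearMap.inl ℝ E E) LinearMap.inl_injective)
    obtain ⟨ι, b, -⟩ := exists_hilbertBasis ℝ E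
    obtain ⟨κ, c, -⟩ := exists_hilbertBasis ℝ F
    have hι : Infinite ι := by
      by_contra h
      rw [not_infinite_iff_finite] at h
      exact hE (HilbertBasis.finiteDimensional b)
    have hκ : Infinite κ := by
      by_contra h
      rw [not_infinite_iff_finite] at h
      exact hF (HilbertBasis.finiteDimensional c)
    have h1 := mk_hilbertBasis_le b c
      ((ContinuousLinearMap.fst ℝ F F).comp (e : (E × E) →L[ℝ] (F × F)))
      (Prod.fst_surjective.comp e.surjective)
    have h2 := mk_hilbertBasis_le c b
      ((ContinuousLinearMap.fst ℝ E E).comp (e.symm : (F × F) →L[ℝ] (E × E)))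
      (Prod.fst_surjective.comp e.symm.surjective)
    obtain ⟨s⟩ := Cardinal.eq.1 (le_antisymm h2 h1)
    have hr : Set.range (c ∘ s) = Set.range c := s.surjective.range_comp c
    let b' : HilbertBasis ι ℝ F := HilbertBasis.mk (c.orthonormal.comp s s.injective)
      (by rw [hr, c.dense_span])
    exact ⟨b.repr.trans b'.repr.symm⟩

/-- A coercive bounded symmetric form is the inner product of an equivalent Hilbert space. -/
theorem exists_hilbert_of_coercive {F : Type u} [NormedAddCommGroup F] [NormedSpace ℝ F]
    [CompleteSpace F] (g : F →L[ℝ] F →L[ℝ] ℝ) (hs : ∀ x y, g x y = g y x) {c : ℝ} (hc : 0 < c)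
    (hg : ∀ x, c * ‖x‖ ^ 2 ≤ g x x) :
    ∃ (H : Type u) (_ : NormedAddCommGroup H) (_ : InnerProductSpace ℝ H) (_ : CompleteSpace H)
      (S : F ≃L[ℝ] H), ∀ x y, ⟪S x, S y⟫_ℝ = g x y := by
  -- The form defines the norm of a copy of F, so that the two norms can be compared.
  let i : F ≃ₗ[ℝ] FormSpace F := LinearEquiv.refl ℝ F
  let core : InnerProductSpace.Core ℝ (FormSpace F) :=
    { inner := fun x y => g (i.symm x) (i.symm y)
      conj_inner_symm := fun x y => hs _ _
      re_inner_nonneg := fun x => (by positivity : 0 ≤ c * ‖i.symm x‖ ^ 2).trans (hg _)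
      add_left := fun x y z => by simp
      smul_left := fun x y r => by simp
      definite := fun x hx => by
        have h := hg (i.symm x)
        have hx' : g (i.symm x) (i.symm x) = 0 := hx
        rw [hx'] at h
        have h0 : ‖i.symm x‖ ^ 2 = 0 := by nlinarith [sq_nonneg ‖i.symm x‖]
        simpa using h0 }
  let _ : NormedAddCommGroup (FormSpace F) := core.toNormedAddCommGroup
  let _ : InnerProductSpace ℝ (FormSpace F) := InnerProductSpace.ofCore core.toCore
  have hi : ∀ x y : F, ⟪i x, i y⟫_ℝ = g x y := fun x y => rfl
  have hn : ∀ x : F, ‖i x‖ ^ 2 = g x x := fun x => by rw [← real_inner_self_eq_norm_sq, hi]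
  let S : F ≃L[ℝ] FormSpace F := i.toContinuousLinearEquivOfBounds (√‖g‖) ((√c)⁻¹)
    (fun x => by
      refine abs_le_of_sq_le_sq' ?_ (by positivity) |>.2
      rw [hn, mul_pow, Real.sq_sqrt (norm_nonneg g), sq, ← mul_assoc]
      exact (le_abs_self _).trans (g.le_opNorm₂ x x))
    (fun y => by
      obtain ⟨x, rfl⟩ := i.surjective y
      rw [i.symm_apply_apply, inv_mul_eq_div, le_div_iff₀ (by positivity)]
      refine abs_le_of_sq_le_sq' ?_ (by positivity) |>.2
      rw [hn, mul_pow, Real.sq_sqrt hc.le, mul_comm]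
      exact hg x)
  refine ⟨FormSpace F, _, _, ?_, S, hi⟩
  exact (completeSpace_congr S.isUniformEmbedding (e := S.toEquiv)).1 inferInstance

/-- If the doubles of a Hilbert space `E` and of `F` are homeomorphic, then `E` is isometric to `F`
with any coercive bounded symmetric form. -/
theorem exists_equiv_of_coercive {F : Type u} [NormedAddCommGroup F] [NormedSpace ℝ F]
    [CompleteSpace E] [CompleteSpace F] (g : F →L[ℝ] F →L[ℝ] ℝ) (hs : ∀ x y, g x y = g y x) {c : ℝ}
    (hc : 0 < c) (hg : ∀ x, c * ‖x‖ ^ 2 ≤ g x x) (e : (E × E) ≃L[ℝ] (F × F)) :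
    ∃ T : E ≃L[ℝ] F, ∀ x y, g (T x) (T y) = ⟪x, y⟫_ℝ := by
  obtain ⟨H, _, _, _, S, hS⟩ := exists_hilbert_of_coercive g hs hc hg
  obtain ⟨f⟩ := nonempty_linearIsometryEquiv_of_double (e.trans (S.prodCongr S))
  refine ⟨f.toContinuousLinearEquiv.trans S.symm, fun x y => ?_⟩
  rw [← hS]
  simp

/-- A positive symmetric operator with a bounded left inverse is coercive. -/
theorem exists_coercive_of_left_inverse {A B : E →L[ℝ] E}
    (hs : ∀ x y, ⟪A x, y⟫_ℝ = ⟪x, A y⟫_ℝ) (hp : ∀ x, 0 ≤ ⟪A x, x⟫_ℝ) (hB : ∀ x, B (A x) = x) :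
    ∃ c : ℝ, 0 < c ∧ ∀ x, c * ‖x‖ ^ 2 ≤ ⟪A x, x⟫_ℝ := by
  -- The added ones keep the constant positive even on the zero space.
  have hb : 0 < ‖B‖ + 1 := by positivity
  have hq : 0 < (‖B‖ + 1) ^ 2 * (‖A‖ + 1) := by positivity
  refine ⟨((‖B‖ + 1) ^ 2 * (‖A‖ + 1))⁻¹, inv_pos.2 hq, fun x => ?_⟩
  let f : LinearMap.BilinForm ℝ E := (innerₗ E).comp A.toLinearMap
  have hf : ∀ x y, f x y = ⟪A x, y⟫_ℝ := fun x y => rfl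
  -- Cauchy–Schwarz for the form ⟨A x, y⟩ at x and A x bounds ‖A x‖² by a multiple of ⟨A x, x⟩; the
  -- left inverse bounds ‖x‖ by a multiple of ‖A x‖.
  have hcs := f.apply_sq_le_of_symm hp ⟨fun x y => by
    simp only [hf, RingHom.id_apply]; rw [hs, real_inner_comm]⟩ x (A x)
  simp only [hf] at hcs
  rw [real_inner_self_eq_norm_sq] at hcs
  have h1 : ⟪A (A x), A x⟫_ℝ ≤ (‖A‖ + 1) * ‖A x‖ ^ 2 := by
    refine (real_inner_le_norm _ _).trans ?_
    have := A.le_opNorm (A x)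
    nlinarith [norm_nonneg (A x)]
  have h2 : ‖x‖ ≤ (‖B‖ + 1) * ‖A x‖ := by
    have := B.le_opNorm (A x)
    rw [hB] at this
    nlinarith [norm_nonneg (A x)]
  have h3 : ‖A x‖ ^ 2 ≤ (‖A‖ + 1) * ⟪A x, x⟫_ℝ := by
    rcases (sq_nonneg ‖A x‖).eq_or_lt with h | h
    · rw [← h]
      have := hp x
      positivity
    · have := mul_le_mul_of_nonneg_left h1 (hp x)
      nlinarith
  rw [inv_mul_le_iff₀ hq]
  have h4 : ‖x‖ ^ 2 ≤ (‖B‖ + 1) ^ 2 * ‖A x‖ ^ 2 := by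
    rw [← mul_pow]
    gcongr
  nlinarith [mul_le_mul_of_nonneg_left h3 (sq_nonneg (‖B‖ + 1))]

end HilbertDimension

/-! ### The symplectic form and Lagrangian subspaces -/

section Symplectic

variable {X : Type*} [NormedAddCommGroup X] [InnerProductSpace ℝ X]

/-- The operator `Ω (y₁ ⊕ y₂) = (-y₂) ⊕ y₁`. -/
def Omega : Dbl X →L[ℝ] Dbl X :=
  ((WithLp.prodContinuousLinearEquiv 2 ℝ X X).symm : X × X →L[ℝ] Dbl X) ∘L
    ((-ContinuousLinearMap.snd ℝ X X).prod (ContinuousLinearMap.fst ℝ X X)) ∘L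
      ((WithLp.prodContinuousLinearEquiv 2 ℝ X X) : Dbl X →L[ℝ] X × X)

theorem Omega_apply (y : Dbl X) : Omega y = WithLp.toLp 2 (-y.snd, y.fst) := rfl

theorem omega_eq_inner (x y : Dbl X) : omega x y = ⟪x, Omega y⟫_ℝ := rfl

theorem omega_eq (x y : Dbl X) : omega x y = -⟪x.fst, y.snd⟫_ℝ + ⟪x.snd, y.fst⟫_ℝ := by
  simp [omega, WithLp.prod_inner_apply]

@[simp]
theorem Omega_Omega (x : Dbl X) : Omega (Omega x) = -x := by
  simp only [Omega_apply]
  rfl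

theorem omega_skew (x y : Dbl X) : omega x y = -omega y x := by
  rw [omega_eq, omega_eq, real_inner_comm x.fst, real_inner_comm x.snd]
  ring

theorem omega_self (x : Dbl X) : omega x x = 0 := by
  linarith [omega_skew x x]

theorem inner_Omega_left (x y : Dbl X) : ⟪Omega x, y⟫_ℝ = -omega x y := by
  rw [real_inner_comm, ← omega_eq_inner, omega_skew]

theorem inner_Omega_Omega (x y : Dbl X) : ⟪Omega x, Omega y⟫_ℝ = ⟪x, y⟫_ℝ := by
  rw [inner_Omega_left, omega_eq_inner, Omega_Omega, inner_neg_right, neg_neg]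

theorem omega_Omega_right (x y : Dbl X) : omega x (Omega y) = -⟪x, y⟫_ℝ := by
  rw [omega_eq_inner, Omega_Omega, inner_neg_right]

theorem omega_Omega_left (x y : Dbl X) : omega (Omega x) y = ⟪x, y⟫_ℝ := by
  rw [omega_eq_inner, inner_Omega_Omega]

theorem omega_add_left (x y z : Dbl X) : omega (x + y) z = omega x z + omega y z := by
  simp only [omega_eq_inner, inner_add_left]

theorem omega_add_right (x y z : Dbl X) : omega x (y + z) = omega x y + omega x z := by
  simp only [omega_eq_inner, map_add, inner_add_right]

theorem omega_sub_left (x y z : Dbl X) : omega (x - y) z = omega x z - omega y z := by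
  simp only [omega_eq_inner, inner_sub_left]

theorem omega_sub_right (x y z : Dbl X) : omega x (y - z) = omega x y - omega x z := by
  simp only [omega_eq_inner, map_sub, inner_sub_right]

theorem omega_neg_left (x y : Dbl X) : omega (-x) y = -omega x y := by
  simp only [omega_eq_inner, inner_neg_left]

theorem omega_neg_right (x y : Dbl X) : omega x (-y) = -omega x y := by
  simp only [omega_eq_inner, map_neg, inner_neg_right]

theorem omega_smul_left (c : ℝ) (x y : Dbl X) : omega (c • x) y = c * omega x y := by
  simp only [omega_eq_inner, real_inner_smul_left]

theorem omega_smul_right (c : ℝ) (x y : Dbl X) : omega x (c • y) = c * omega x y := by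
  simp only [omega_eq_inner, map_smul, real_inner_smul_right]

theorem omega_zero_left (x : Dbl X) : omega 0 x = 0 := by
  simp only [omega_eq_inner, inner_zero_left]

theorem omega_zero_right (x : Dbl X) : omega x 0 = 0 := by
  simp only [omega_eq_inner, map_zero, inner_zero_right]

theorem hasDerivAt_omega {x y : ℝ → Dbl X} {x' y' : Dbl X} {u : ℝ} (hx : HasDerivAt x x' u)
    (hy : HasDerivAt y y' u) :
    HasDerivAt (fun t => omega (x t) (y t)) (omega x' (y u) + omega (x u) y') u := by
  have h := hx.inner ℝ ((Omega (X := X)).hasFDerivAt.comp_hasDerivAt u hy)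
  rw [add_comm] at h
  exact h

theorem IsLagrangian.omega_eq_zero {L : Submodule ℝ (Dbl X)} (hL : IsLagrangian L) {x y : Dbl X}
    (hx : x ∈ L) (hy : y ∈ L) : omega x y = 0 :=
  hL.prop x hx y hy

/-- A Lagrangian subspace is its own symplectic complement. -/
theorem IsLagrangian.mem_of_omega_eq_zero {L : Submodule ℝ (Dbl X)} (hL : IsLagrangian L)
    {x : Dbl X} (hx : ∀ y ∈ L, omega y x = 0) : x ∈ L := by
  have hx' : ∀ y ∈ L, omega x y = 0 := fun y hy => by rw [omega_skew, hx y hy, neg_zero]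
  -- Adjoining x keeps L isotropic, so maximality puts x in L.
  have : IsIsotropic (L ⊔ ℝ ∙ x) := by
    intro a' ha' b' hb'
    obtain ⟨a, ha, c, hc, rfl⟩ := Submodule.mem_sup.1 ha'
    obtain ⟨b, hb, d, hd, rfl⟩ := Submodule.mem_sup.1 hb'
    obtain ⟨r, rfl⟩ := Submodule.mem_span_singleton.1 hc
    obtain ⟨s, rfl⟩ := Submodule.mem_span_singleton.1 hd
    simp only [omega_add_left, omega_add_right, omega_smul_left, omega_smul_right,
      hL.omega_eq_zero ha hb, hx a ha, hx' b hb, omega_self]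
    ring
  exact hL.le_of_ge this le_sup_left (Submodule.mem_sup_right (Submodule.mem_span_singleton_self x))

/-- If a function is constant on an open set, its derivatives there vanish. -/
theorem hasDerivAt_eq_zero_of_const {E : Type*} [NormedAddCommGroup E] [NormedSpace ℝ E]
    {V : Set ℝ} (hV : IsOpen V) {f : ℝ → E} {c f' : E} {u : ℝ} (hf : ∀ t ∈ V, f t = c)
    (hu : u ∈ V) (h : HasDerivAt f f' u) : f' = 0 := by
  refine h.unique ((hasDerivAt_const u c).congr_of_eventuallyEq ?_)
  filter_upwards [hV.mem_nhds hu] with t ht using hf t ht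

end Symplectic

/-! ### Normal frames and their uniqueness -/

section Frame

variable {X : Type*} [NormedAddCommGroup X] [InnerProductSpace ℝ X]
variable {E : Type*} [NormedAddCommGroup E] [NormedSpace ℝ E]

/-- A normal frame of the curve `K` on `V`: operators `W u` with range `K u`, normalized by
`ω(W a, W' b) = -g(a, b)` and such that `W'' = -W q`. -/
structure IsNormalFrame (V : Set ℝ) (K : ℝ → Submodule ℝ (Dbl X)) (g : E → E → ℝ)
    (q : ℝ → E →L[ℝ] E) (W W' : ℝ → E →L[ℝ] Dbl X) : Prop where
  hasDerivAt : ∀ u ∈ V, HasDerivAt W (W' u) u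
  hasDerivAt' : ∀ u ∈ V, HasDerivAt W' (-(W u ∘L q u)) u
  range : ∀ u ∈ V, ∀ z, z ∈ K u ↔ ∃ a, W u a = z
  pairing : ∀ u ∈ V, ∀ a b, omega (W u a) (W' u b) = -g a b

namespace IsNormalFrame

variable {V : Set ℝ} {K : ℝ → Submodule ℝ (Dbl X)} {g : E → E → ℝ} {q : ℝ → E →L[ℝ] E}
  {W W' : ℝ → E →L[ℝ] Dbl X}

theorem mem (h : IsNormalFrame V K g q W W') {u : ℝ} (hu : u ∈ V) (a : E) : W u a ∈ K u :=
  (h.range u hu _).2 ⟨a, rfl⟩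

theorem hasDerivAt_apply (h : IsNormalFrame V K g q W W') {u : ℝ} (hu : u ∈ V) (a : E) :
    HasDerivAt (fun t => W t a) (W' u a) u := by
  simpa using (h.hasDerivAt u hu).clm_apply (hasDerivAt_const u a)

theorem hasDerivAt_apply' (h : IsNormalFrame V K g q W W') {u : ℝ} (hu : u ∈ V) (a : E) :
    HasDerivAt (fun t => W' t a) (-W u (q u a)) u := by
  simpa using (h.hasDerivAt' u hu).clm_apply (hasDerivAt_const u a)

/-- The derivative of the constant ω(W a, W' b) is ω(W' a, W' b) + ω(W a, W'' b), and the last term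
vanishes because W'' takes values in K u. -/
theorem omega_deriv_deriv (hV : IsOpen V) (hK : ∀ u ∈ V, IsLagrangian (K u))
    (h : IsNormalFrame V K g q W W') {u : ℝ} (hu : u ∈ V) (a b : E) :
    omega (W' u a) (W' u b) = 0 := by
  have h1 := hasDerivAt_eq_zero_of_const hV (fun t ht => h.pairing t ht a b) hu
    (hasDerivAt_omega (h.hasDerivAt_apply hu a) (h.hasDerivAt_apply' hu b))
  rwa [omega_neg_right, (hK u hu).omega_eq_zero (h.mem hu _) (h.mem hu _), neg_zero,
    add_zero] at h1

/-- Two normal frames of the same curve differ by a constant isometry. -/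
theorem exists_equiv [CompleteSpace X] [CompleteSpace E] (hV : IsOpen V) (hc : V.OrdConnected)
    (hne : V.Nonempty) (hK : ∀ u ∈ V, IsLagrangian (K u))
    (hg : ∀ a, g a a = 0 → a = 0)
    (h : IsNormalFrame V K g q W W')
    {p : ℝ → X →L[ℝ] X} {Z Z' : ℝ → X →L[ℝ] Dbl X}
    (hZ : IsNormalFrame V K (fun x y => ⟪x, y⟫_ℝ) p Z Z') :
    ∃ T : X ≃L[ℝ] E, (∀ x y, g (T x) (T y) = ⟪x, y⟫_ℝ) ∧
      ∀ u ∈ V, ∀ x, T (p u x) = q u (T x) := by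
  obtain ⟨v, hv⟩ := hne
  -- Since ω(Z' b, Z c) = ⟨b, c⟩, this reads off the coordinates of W v in the frame Z v.
  let C : E →L[ℝ] X := (Z' v).adjoint ∘L Omega ∘L W v
  -- Differentiating ω(Z, W) = 0 twice leaves 2 ω(Z', W') = 0, as Z'' and W'' take values in K. This
  -- is the derivative of ω(Z', W).
  have hconst : ∀ u ∈ V, ∀ b a, omega (Z' u b) (W u a) = ⟪b, C a⟫_ℝ := by
    intro u hu b a
    have h0 : ⟪b, C a⟫_ℝ = omega (Z' v b) (W v a) := by
      simp [C, ContinuousLinearMap.adjoint_inner_right, omega_eq_inner]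
    rw [h0]
    refine eq_of_hasDerivAt_zero hV hc (f := fun t => omega (Z' t b) (W t a)) (fun t ht => ?_) hu hv
    have d0 : ∀ s ∈ V, omega (Z s b) (W s a) = 0 := fun s hs =>
      (hK s hs).omega_eq_zero (hZ.mem hs _) (h.mem hs _)
    have d1 : ∀ s ∈ V, omega (Z' s b) (W s a) + omega (Z s b) (W' s a) = 0 := fun s hs =>
      hasDerivAt_eq_zero_of_const hV d0 hs
        (hasDerivAt_omega (hZ.hasDerivAt_apply hs b) (h.hasDerivAt_apply hs a))
    have e1 := hasDerivAt_omega (hZ.hasDerivAt_apply' ht b) (h.hasDerivAt_apply ht a)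
    have e2 := hasDerivAt_omega (hZ.hasDerivAt_apply ht b) (h.hasDerivAt_apply' ht a)
    have d2 := hasDerivAt_eq_zero_of_const hV d1 ht (e1.add e2)
    rw [omega_neg_left, (hK t ht).omega_eq_zero (hZ.mem ht _) (h.mem ht _), neg_zero,
      zero_add] at e1 d2
    rw [omega_neg_right, (hK t ht).omega_eq_zero (hZ.mem ht _) (h.mem ht _), neg_zero,
      add_zero] at d2
    have d3 : omega (Z' t b) (W' t a) = 0 := by linarith
    rwa [d3] at e1
  have hZC : ∀ u ∈ V, ∀ a, Z u (C a) = W u a := by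
    intro u hu a
    obtain ⟨c, hc⟩ := (hZ.range u hu _).1 (h.mem hu a)
    rw [← hc]
    congr 1
    refine ext_inner_left ℝ fun b => ?_
    rw [← hconst u hu, ← hc, omega_skew, hZ.pairing u hu, neg_neg, real_inner_comm]
  have hZC' : ∀ u ∈ V, ∀ a, Z' u (C a) = W' u a := fun u hu a =>
    ((hZ.hasDerivAt_apply hu (C a)).congr_of_eventuallyEq (by
      filter_upwards [hV.mem_nhds hu] with t ht using (hZC t ht a).symm)).unique
      (h.hasDerivAt_apply hu a)
  have hCi : ∀ a b, ⟪C a, C b⟫_ℝ = g a b := by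
    intro a b
    have := h.pairing v hv a b
    rw [← hZC v hv, ← hZC' v hv, hZ.pairing v hv] at this
    linarith
  have hZinj : ∀ u ∈ V, ∀ x y, Z u x = Z u y → x = y := by
    intro u hu x y hxy
    refine ext_inner_right ℝ fun b => ?_
    have h1 := hZ.pairing u hu x b
    have h2 := hZ.pairing u hu y b
    rw [hxy] at h1
    linarith
  have hker : C.ker = ⊥ := by
    rw [LinearMap.ker_eq_bot']
    intro a ha
    refine hg a ?_
    rw [← hCi]
    exact (congrArg (fun z => ⟪z, z⟫_ℝ) ha).trans (inner_zero_left _)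
  have hrange : C.range = ⊤ := by
    rw [LinearMap.range_eq_top]
    intro x
    obtain ⟨a, ha⟩ := (h.range v hv _).1 (hZ.mem hv x)
    exact ⟨a, hZinj v hv _ _ ((hZC v hv a).trans ha)⟩
  let Ce := ContinuousLinearEquiv.ofBijective C hker hrange
  have hCe : ∀ x, C (Ce.symm x) = x := fun x =>
    ContinuousLinearEquiv.ofBijective_apply_symm_apply C hker hrange x
  refine ⟨Ce.symm, fun x y => by rw [← hCi, hCe, hCe], fun u hu x => ?_⟩
  obtain ⟨a, rfl⟩ := Ce.surjective x
  have hCea : Ce a = C a := rfl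
  rw [Ce.symm_apply_apply, Ce.symm_apply_eq]
  change p u (C a) = C (q u a)
  refine hZinj u hu _ _ ?_
  -- Second derivatives of Z C = W: Z p C = W q = Z C q, and Z is injective.
  have := ((hZ.hasDerivAt_apply' hu (C a)).congr_of_eventuallyEq (by
      filter_upwards [hV.mem_nhds hu] with t ht using (hZC' t ht a).symm)).unique
      (h.hasDerivAt_apply' hu a)
  rw [hZC u hu]
  exact neg_inj.1 this

end IsNormalFrame

end Frame

/-! ### Adjoints and operators representing forms -/

section Adjoint

variable {E F : Type*} [NormedAddCommGroup E] [InnerProductSpace ℝ E] [CompleteSpace E]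
  [NormedAddCommGroup F] [InnerProductSpace ℝ F] [CompleteSpace F]

/-- Taking adjoints, as a real linear map. -/
def adjointL : (E →L[ℝ] F) →L[ℝ] (F →L[ℝ] E) :=
  LinearMap.mkContinuous
    { toFun := fun A => A.adjoint
      map_add' := fun A B => map_add _ A B
      map_smul' := fun c A => by simp } 1 (fun A => by simp)

theorem hasDerivAt_adjoint {A : ℝ → E →L[ℝ] F} {A' : E →L[ℝ] F} {u : ℝ} (h : HasDerivAt A A' u) :
    HasDerivAt (fun t => (A t).adjoint) A'.adjoint u :=
  (adjointL (E := E) (F := F)).hasFDerivAt.comp_hasDerivAt u h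

theorem contDiffOn_adjoint {A : ℝ → E →L[ℝ] F} {V : Set ℝ} (h : ContDiffOn ℝ ∞ A V) :
    ContDiffOn ℝ ∞ (fun t => (A t).adjoint) V :=
  (adjointL (E := E) (F := F)).contDiff.comp_contDiffOn h

/-- The operator representing the form `-⟪A a, O (B b)⟫`. -/
def formOperator (O : F →L[ℝ] F) (A B : E →L[ℝ] F) : E →L[ℝ] E :=
  -(A.adjoint ∘L O ∘L B)

theorem inner_formOperator (O : F →L[ℝ] F) (A B : E →L[ℝ] F) (a b : E) :
    ⟪a, formOperator O A B b⟫_ℝ = -⟪A a, O (B b)⟫_ℝ := by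
  rw [← ContinuousLinearMap.adjoint_inner_right, ← inner_neg_right]
  rfl

theorem contDiffOn_formOperator {A B : ℝ → E →L[ℝ] F} {V : Set ℝ} (O : F →L[ℝ] F)
    (hA : ContDiffOn ℝ ∞ A V) (hB : ContDiffOn ℝ ∞ B V) :
    ContDiffOn ℝ ∞ (fun t => formOperator O (A t) (B t)) V :=
  ((contDiffOn_adjoint hA).clm_comp (contDiffOn_const.clm_comp hB)).neg

theorem hasDerivAt_formOperator {A B : ℝ → E →L[ℝ] F} {A' B' : E →L[ℝ] F} {u : ℝ}
    (O : F →L[ℝ] F) (hA : HasDerivAt A A' u) (hB : HasDerivAt B B' u) :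
    HasDerivAt (fun t => formOperator O (A t) (B t))
      (formOperator O A' (B u) + formOperator O (A u) B') u := by
  refine ((hasDerivAt_adjoint hA).clm_comp
    ((hasDerivAt_const u O).clm_comp hB)).neg.congr_deriv ?_
  simp [formOperator, add_comm]

end Adjoint

/-! ### From a normal frame to a canonical transformation -/

section Solutions

variable {X : Type*} [NormedAddCommGroup X] [InnerProductSpace ℝ X]
variable {U : Opens ℝ} {p : ℝ → X →L[ℝ] X}

theorem solution_hasDerivAt (f : solutionSpace U p) {u : ℝ} (hu : u ∈ U) :
    HasDerivAt f.1 (deriv f.1 u) u :=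
  ((f.2.1.contDiffAt (U.isOpen.mem_nhds hu)).differentiableAt (by simp)).hasDerivAt

theorem solution_hasDerivAt' (f : solutionSpace U p) {u : ℝ} (hu : u ∈ U) :
    HasDerivAt (deriv f.1) (-p u (f.1 u)) u := by
  have h := ((f.2.1.deriv_of_isOpen U.isOpen (m := ∞) (by simp)).contDiffAt
    (U.isOpen.mem_nhds hu)).differentiableAt (by simp)
  rw [← eq_neg_of_add_eq_zero_left (f.2.2.1 u hu)]
  exact h.hasDerivAt

/-- Cauchy data at a point, as a linear map. -/
def cauchyDataL (u : ℝ) (hu : u ∈ U) : solutionSpace U p →ₗ[ℝ] Dbl X where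
  toFun := cauchyData u
  map_add' f g := by
    have := ((solution_hasDerivAt f hu).add (solution_hasDerivAt g hu)).deriv
    simp only [cauchyData, Submodule.coe_add, Pi.add_apply, this]
    rfl
  map_smul' c f := by
    have := ((solution_hasDerivAt f hu).const_smul c).deriv
    simp only [cauchyData, Submodule.coe_smul, Pi.smul_apply, this]
    rfl

variable [CompleteSpace X]

theorem inner_formOperator_Omega (A B : X →L[ℝ] Dbl X) (a b : X) :
    ⟪a, formOperator Omega A B b⟫_ℝ = -omega (A a) (B b) :=
  inner_formOperator _ _ _ _ _

theorem contDiffOn_formOperator_Omega {A B : ℝ → X →L[ℝ] Dbl X} {V : Set ℝ}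
    (hA : ContDiffOn ℝ ∞ A V) (hB : ContDiffOn ℝ ∞ B V) :
    ContDiffOn ℝ ∞ (fun t => formOperator Omega (A t) (B t)) V :=
  contDiffOn_formOperator (A := A) (B := B) Omega hA hB

theorem hasDerivAt_formOperator_Omega {A B : ℝ → X →L[ℝ] Dbl X} {A' B' : X →L[ℝ] Dbl X} {u : ℝ}
    (hA : HasDerivAt A A' u) (hB : HasDerivAt B B' u) :
    HasDerivAt (fun t => formOperator Omega (A t) (B t))
      (formOperator Omega A' (B u) + formOperator Omega (A u) B') u :=
  hasDerivAt_formOperator (A := A) (B := B) (A' := A') (B' := B') Omega hA hB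

/-- This is the skew-symmetry of ω. With A = B = F' it makes one of the two terms in the derivative
of the tangent form skew. -/
theorem adjoint_formOperator_Omega (A B : X →L[ℝ] Dbl X) :
    (formOperator Omega A B).adjoint = -formOperator Omega B A := by
  refine ContinuousLinearMap.ext fun a => ext_inner_left ℝ fun b => ?_
  rw [ContinuousLinearMap.adjoint_inner_right, neg_apply, inner_neg_right,
    inner_formOperator_Omega, real_inner_comm, inner_formOperator_Omega, omega_skew]

namespace IsNormalFrame

variable {K : ℝ → Submodule ℝ (Dbl X)} {W W' : ℝ → X →L[ℝ] Dbl X}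

/-- The operator `(x, y) ↦ -W' x + W y`. -/
def ofData (A B : X →L[ℝ] Dbl X) : Dbl X →L[ℝ] Dbl X :=
  (-B).coprod A ∘L (WithLp.prodContinuousLinearEquiv 2 ℝ X X : Dbl X →L[ℝ] X × X)

omit [CompleteSpace X] in
theorem ofData_apply (A B : X →L[ℝ] Dbl X) (z : Dbl X) :
    ofData A B z = -B z.fst + A z.snd := rfl

/-- The operator `t ↦ (W* Ω t, W'* Ω t)`. -/
def toData (A B : X →L[ℝ] Dbl X) : Dbl X →L[ℝ] Dbl X :=
  ((WithLp.prodContinuousLinearEquiv 2 ℝ X X).symm : X × X →L[ℝ] Dbl X) ∘L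
    (A.adjoint.prod B.adjoint) ∘L Omega

theorem toData_apply (A B : X →L[ℝ] Dbl X) (z : Dbl X) :
    toData A B z = WithLp.toLp 2 (A.adjoint (Omega z), B.adjoint (Omega z)) := rfl

theorem inner_adjoint_Omega (A : X →L[ℝ] Dbl X) (b : X) (z : Dbl X) :
    ⟪b, A.adjoint (Omega z)⟫_ℝ = omega (A b) z := by
  rw [ContinuousLinearMap.adjoint_inner_right, omega_eq_inner]

variable {V : Set ℝ} {q : ℝ → X →L[ℝ] X}

/-- W and W' satisfy the relations of a symplectic basis, so pairing with them recovers the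
coordinates. -/
theorem toData_ofData (hV : IsOpen V) (hK : ∀ u ∈ V, IsLagrangian (K u))
    (h : IsNormalFrame V K (fun x y => ⟪x, y⟫_ℝ) q W W') {u : ℝ} (hu : u ∈ V) (z : Dbl X) :
    toData (W u) (W' u) (ofData (W u) (W' u) z) = z := by
  rw [toData_apply, ofData_apply]
  refine WithLp.ofLp_injective 2 (Prod.ext ?_ ?_)
  · refine ext_inner_left ℝ fun b => ?_
    change ⟪b, (W u).adjoint (Omega _)⟫_ℝ = ⟪b, z.fst⟫_ℝ
    rw [inner_adjoint_Omega, omega_add_right, omega_neg_right, h.pairing u hu,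
      (hK u hu).omega_eq_zero (h.mem hu _) (h.mem hu _)]
    ring
  · refine ext_inner_left ℝ fun b => ?_
    change ⟪b, (W' u).adjoint (Omega _)⟫_ℝ = ⟪b, z.snd⟫_ℝ
    rw [inner_adjoint_Omega, omega_add_right, omega_neg_right, h.omega_deriv_deriv hV hK hu,
      omega_skew _ (W u _), h.pairing u hu, real_inner_comm]
    ring

-- Completeness of the symplectic basis: the first condition puts z in the symplectic complement of
-- K u, which is K u, so z = W c; the second gives c = 0.
omit [CompleteSpace X] in
theorem eq_zero_of_omega (hK : ∀ u ∈ V, IsLagrangian (K u))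
    (h : IsNormalFrame V K (fun x y => ⟪x, y⟫_ℝ) q W W') {u : ℝ} (hu : u ∈ V) {z : Dbl X}
    (h1 : ∀ b, omega (W u b) z = 0) (h2 : ∀ b, omega (W' u b) z = 0) : z = 0 := by
  have hz : z ∈ K u := (hK u hu).mem_of_omega_eq_zero fun y hy => by
    obtain ⟨b, rfl⟩ := (h.range u hu y).1 hy
    exact h1 b
  obtain ⟨c, rfl⟩ := (h.range u hu z).1 hz
  have : c = 0 := ext_inner_left ℝ fun b => by
    have h3 := h2 b
    rw [omega_skew, h.pairing u hu, neg_neg] at h3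
    rw [real_inner_comm, h3, inner_zero_right]
  rw [this, map_zero]

theorem ofData_toData (hV : IsOpen V) (hK : ∀ u ∈ V, IsLagrangian (K u))
    (h : IsNormalFrame V K (fun x y => ⟪x, y⟫_ℝ) q W W') {u : ℝ} (hu : u ∈ V) (z : Dbl X) :
    ofData (W u) (W' u) (toData (W u) (W' u) z) = z := by
  rw [← sub_eq_zero]
  have h0 := toData_ofData hV hK h hu (toData (W u) (W' u) z)
  generalize ofData (W u) (W' u) (toData (W u) (W' u) z) = y at h0 ⊢
  refine eq_zero_of_omega hK h hu (fun b => ?_) (fun b => ?_)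
  · have := congrArg (fun w => ⟪b, w.fst⟫_ℝ) h0
    simp only [toData_apply] at this
    rw [omega_sub_right, ← inner_adjoint_Omega, ← inner_adjoint_Omega]
    exact sub_eq_zero.2 this
  · have := congrArg (fun w => ⟪b, w.snd⟫_ℝ) h0
    simp only [toData_apply] at this
    rw [omega_sub_right, ← inner_adjoint_Omega, ← inner_adjoint_Omega]
    exact sub_eq_zero.2 this

omit [CompleteSpace X] in
theorem omega_ofData (hV : IsOpen V) (hK : ∀ u ∈ V, IsLagrangian (K u))
    (h : IsNormalFrame V K (fun x y => ⟪x, y⟫_ℝ) q W W') {u : ℝ} (hu : u ∈ V) (y z : Dbl X) :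
    omega (ofData (W u) (W' u) y) (ofData (W u) (W' u) z) = omega y z := by
  simp only [ofData_apply, omega_add_left, omega_add_right, omega_neg_left, omega_neg_right,
    h.omega_deriv_deriv hV hK hu, (hK u hu).omega_eq_zero (h.mem hu _) (h.mem hu _),
    omega_skew (W' u _) (W u _), h.pairing u hu]
  rw [omega_eq, real_inner_comm z.snd y.fst]
  ring

/-- A normal frame identifies the solution space with `X ⊕ X`, and its Hamiltonian curve with `K`. -/
theorem exists_canonicalTransformation (hc : (U : Set ℝ).OrdConnected)
    (hne : (U : Set ℝ).Nonempty) (hp : IsPotential U p) (hK : ∀ u ∈ U, IsLagrangian (K u))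
    (hW : ContDiffOn ℝ ∞ W U) (h : IsNormalFrame U K (fun x y => ⟪x, y⟫_ℝ) p W W') :
    ∃ φ : solutionSpace U p ≃ₗ[ℝ] Dbl X, IsCanonicalTransformation φ ∧
      ∀ u ∈ U, (hamiltonianCurve U p u).map φ.toLinearMap = K u := by
  classical
  obtain ⟨v, hv⟩ := hne
  have hV := U.isOpen
  have hd : ∀ z, ∀ u ∈ U, HasDerivAt (fun t => (W t).adjoint (Omega z))
      ((W' u).adjoint (Omega z)) u := fun z u hu => by
    simpa using (hasDerivAt_adjoint (h.hasDerivAt u hu)).clm_apply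
      (hasDerivAt_const u (Omega z))
  have hd' : ∀ z, ∀ u ∈ U, HasDerivAt (fun t => (W' t).adjoint (Omega z))
      (-p u ((W u).adjoint (Omega z))) u := fun z u hu => by
    have := (hasDerivAt_adjoint (h.hasDerivAt' u hu)).clm_apply
      (hasDerivAt_const u (Omega z))
    have hs : (p u).adjoint = p u := hp.2 u hu
    simpa [ContinuousLinearMap.adjoint_comp, hs] using this
  -- In the derivative of -W' f + W f' the first-order terms cancel, and W'' = -W p cancels f'' = -p
  -- f.
  have hconst : ∀ f : solutionSpace U p, ∀ u ∈ U,
      ofData (W u) (W' u) (cauchyData u f) = ofData (W v) (W' v) (cauchyData v f) := by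
    intro f u hu
    refine eq_of_hasDerivAt_zero hV hc
      (f := fun t => ofData (W t) (W' t) (cauchyData t f)) (fun t ht => ?_) hu hv
    have e := (((h.hasDerivAt' t ht).clm_apply (solution_hasDerivAt f ht)).neg).add
      ((h.hasDerivAt t ht).clm_apply (solution_hasDerivAt' f ht))
    refine e.congr_deriv ?_
    simp only [neg_add_rev, neg_apply,
      ContinuousLinearMap.coe_comp, Function.comp_apply, map_neg, neg_neg]
    abel
  -- The inverse is explicit: taking adjoints in W'' = -W p, with p self-adjoint, shows that W* Ω z
  -- solves the equation on U.
  let inv : Dbl X → ℝ → X := fun z u => if u ∈ U then (W u).adjoint (Omega z) else 0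
  have hinv : ∀ z, ∀ u ∈ U, inv z =ᶠ[𝓝 u] fun t => (W t).adjoint (Omega z) := by
    intro z u hu
    filter_upwards [hV.mem_nhds hu] with t ht
    simp only [inv]
    exact if_pos ht
  have hinvd : ∀ z, ∀ u ∈ U, deriv (inv z) u = (W' u).adjoint (Omega z) := fun z u hu => by
    rw [(hinv z u hu).deriv_eq, (hd z u hu).deriv]
  have hsol : ∀ z, inv z ∈ solutionSpace U p := by
    intro z
    refine ⟨?_, fun u hu => ?_, fun u hu => if_neg hu⟩
    · exact ((contDiffOn_adjoint hW).clm_apply contDiffOn_const).congr fun u hu => if_pos hu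
    · have : deriv (inv z) =ᶠ[𝓝 u] fun t => (W' t).adjoint (Omega z) := by
        filter_upwards [hV.mem_nhds hu] with t ht using hinvd z t ht
      rw [this.deriv_eq, (hd' z u hu).deriv, (hinv z u hu).eq_of_nhds, neg_add_cancel]
  have hdata : ∀ z, ∀ u ∈ U, cauchyData u ⟨inv z, hsol z⟩ = toData (W u) (W' u) z := by
    intro z u hu
    simp only [cauchyData, hinvd z u hu, (hinv z u hu).eq_of_nhds]
    rfl
  let φ : solutionSpace U p ≃ₗ[ℝ] Dbl X :=
    { (ofData (W v) (W' v)).toLinearMap ∘ₗ cauchyDataL v hv with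
      invFun := fun z => ⟨inv z, hsol z⟩
      left_inv := fun f => by
        refine Subtype.ext (funext fun u => ?_)
        change inv (ofData (W v) (W' v) (cauchyData v f)) u = f.1 u
        by_cases hu : u ∈ U
        · rw [← hconst f u hu, (hinv _ u hu).eq_of_nhds]
          have := toData_ofData hV hK h hu (cauchyData u f)
          rw [toData_apply] at this
          exact congrArg WithLp.fst this
        · rw [f.2.2.2 u hu]
          exact if_neg hu
      right_inv := fun z => by
        change ofData (W v) (W' v) (cauchyData v ⟨inv z, hsol z⟩) = z
        rw [hdata z v hv, ofData_toData hV hK h hv] }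
  have hφ : ∀ f, ∀ u ∈ U, φ f = ofData (W u) (W' u) (cauchyData u f) := fun f u hu =>
    (hconst f u hu).symm
  refine ⟨φ, fun u hu => ⟨⟨ContinuousLinearEquiv.equivOfInverse (ofData (W u) (W' u))
    (toData (W u) (W' u)) (toData_ofData hV hK h hu) (ofData_toData hV hK h hu),
    fun f => hφ f u hu⟩, fun f g => ?_⟩, fun u hu => ?_⟩
  · rw [hφ f u hu, hφ g u hu, omega_ofData hV hK h hu]
  · ext z
    rw [Submodule.mem_map]
    constructor
    · rintro ⟨f, hf, rfl⟩
      have hf0 : f.1 u = 0 := hf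
      change φ f ∈ K u
      rw [hφ f u hu, ofData_apply]
      rw [show (cauchyData u f).fst = 0 from hf0, map_zero, neg_zero, zero_add]
      exact h.mem hu _
    · intro hz
      refine ⟨φ.symm z, ?_, φ.apply_symm_apply z⟩
      change inv z u = 0
      rw [(hinv z u hu).eq_of_nhds]
      refine ext_inner_left ℝ fun b => ?_
      rw [inner_adjoint_Omega, (hK u hu).omega_eq_zero (h.mem hu _) hz, inner_zero_right]

end IsNormalFrame

end Solutions

/-! ### Positive hyperbolic structures -/

section Hyperbolic

universe u

variable {X : Type u} [NormedAddCommGroup X] [InnerProductSpace ℝ X]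
  {J R : Dbl X →L[ℝ] Dbl X}

namespace IsPositiveHyperbolic

theorem omega_symm (h : IsPositiveHyperbolic J R) (x y : Dbl X) :
    omega (J x) y = omega (J y) x := by
  rw [← h.symplectic, h.sq_left, omega_neg_left, ← omega_skew]

theorem omega_right (h : IsPositiveHyperbolic J R) (x y : Dbl X) :
    omega x (J y) = -omega (J x) y := by
  rw [omega_skew, h.omega_symm]

theorem reflection_apply (a : plusSpace R) : R a = a := a.2

theorem reflection_left (h : IsPositiveHyperbolic J R) (x : Dbl X) : R (J x) = -J (R x) :=
  eq_neg_of_add_eq_zero_right (h.anticomm x)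

theorem omega_plus (h : IsPositiveHyperbolic J R) (a b : plusSpace R) :
    omega (a : Dbl X) b = 0 := by
  have := h.antisymplectic a b
  rw [reflection_apply, reflection_apply] at this
  linarith

/-- Both eigenspaces are isotropic, so only the mixed terms survive. Thus isotropy of the graph of J
∘ H is symmetry of H for the form ω(J x, y). -/
theorem omega_graph (h : IsPositiveHyperbolic J R) (a b c d : plusSpace R) :
    omega ((a : Dbl X) + J b) (c + J d) = omega (J b) c - omega (J a) d := by
  rw [omega_add_left, omega_add_right, omega_add_right, h.symplectic, h.omega_plus, h.omega_plus,
    h.omega_right]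
  ring

theorem eq_zero_of_form_eq_zero (h : IsPositiveHyperbolic J R) (a : plusSpace R)
    (ha : omega (J a) a = 0) : a = 0 := by
  by_contra hne
  exact (h.pos a fun h0 => hne (Subtype.ext h0)).ne' ha

theorem eq_of_form_eq (h : IsPositiveHyperbolic J R) {a b : plusSpace R}
    (hab : ∀ c : plusSpace R, omega (J c) a = omega (J c) b) : a = b := by
  rw [← sub_eq_zero]
  refine h.eq_zero_of_form_eq_zero _ ?_
  rw [Submodule.coe_sub, omega_sub_right, ← Submodule.coe_sub, hab, sub_self]

/-- The projection onto the `+1` eigenspace along the `-1` eigenspace. -/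
def plusProj (h : IsPositiveHyperbolic J R) : Dbl X →L[ℝ] plusSpace R :=
  ((2⁻¹ : ℝ) • (ContinuousLinearMap.id ℝ (Dbl X) + R)).codRestrict (plusSpace R) fun x => by
    change R ((2⁻¹ : ℝ) • (x + R x)) = (2⁻¹ : ℝ) • (x + R x)
    rw [map_smul, map_add, h.sq_right, add_comm]

theorem coe_plusProj (h : IsPositiveHyperbolic J R) (x : Dbl X) :
    (h.plusProj x : Dbl X) = (2⁻¹ : ℝ) • (x + R x) := rfl

theorem plusProj_graph (h : IsPositiveHyperbolic J R) (a b : plusSpace R) :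
    h.plusProj (a + J b) = a := by
  refine Subtype.ext ?_
  rw [coe_plusProj, map_add, h.reflection_left, reflection_apply, reflection_apply]
  module

theorem plusProj_left_graph (h : IsPositiveHyperbolic J R) (a b : plusSpace R) :
    h.plusProj (-J (a + J b)) = b := by
  refine Subtype.ext ?_
  rw [coe_plusProj, map_add, map_neg, map_add, h.sq_left, h.reflection_left, map_neg,
    reflection_apply, reflection_apply]
  module

theorem plusProj_add (h : IsPositiveHyperbolic J R) (x : Dbl X) :
    (h.plusProj x : Dbl X) + J (h.plusProj (-J x)) = x := by
  rw [coe_plusProj, coe_plusProj, map_neg, h.reflection_left, map_smul, map_add, map_neg, map_neg,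
    map_neg, h.sq_left, h.sq_left]
  module

theorem plusProj_eq_zero_iff (h : IsPositiveHyperbolic J R) (x : Dbl X) :
    h.plusProj x = 0 ↔ x ∈ minusSpace R := by
  rw [← Submodule.coe_eq_zero, coe_plusProj, smul_eq_zero]
  change _ ↔ R x = -x
  rw [eq_neg_iff_add_eq_zero, add_comm]
  simp

/-- `X ⊕ X` is the double of the `+1` eigenspace. -/
def doubleEquiv (h : IsPositiveHyperbolic J R) :
    Dbl X ≃L[ℝ] plusSpace R × plusSpace R :=
  ContinuousLinearEquiv.equivOfInverse (h.plusProj.prod (h.plusProj ∘L (-J)))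
    ((plusSpace R).subtypeL.coprod (J ∘L (plusSpace R).subtypeL))
    (fun x => h.plusProj_add x)
    (fun x => Prod.ext (h.plusProj_graph x.1 x.2) (h.plusProj_left_graph x.1 x.2))

theorem isClosed_plusSpace : IsClosed (plusSpace R : Set (Dbl X)) :=
  isClosed_eq R.continuous continuous_id

instance [CompleteSpace X] : CompleteSpace (plusSpace R) :=
  isClosed_plusSpace.isComplete.completeSpace_coe

/-- Pointwise positivity is enough because the representing operator -Ω J has the bounded left
inverse -J Ω. -/
theorem exists_coercive (h : IsPositiveHyperbolic J R) :
    ∃ c : ℝ, 0 < c ∧ ∀ x, c * ‖x‖ ^ 2 ≤ omega (J x) x := by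
  have hA : ∀ x y, ⟪(-(Omega ∘L J)) x, y⟫_ℝ = omega (J x) y := fun x y => by
    rw [neg_apply, ContinuousLinearMap.comp_apply, inner_neg_left, inner_Omega_left, neg_neg]
  obtain ⟨c, hc, hx⟩ := exists_coercive_of_left_inverse (A := -(Omega ∘L J)) (B := -(J ∘L Omega))
    (fun x y => by rw [hA, real_inner_comm, hA, h.omega_symm])
    (fun x => by
      rw [hA]
      rcases eq_or_ne x 0 with rfl | hx
      · rw [omega_zero_right]
      · exact (h.pos x hx).le)
    (fun x => by simp [h.sq_left])
  exact ⟨c, hc, fun x => by rw [← hA]; exact hx x⟩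

/-- `X` is isometric to the `+1` eigenspace of a positive hyperbolic structure. -/
theorem exists_isometry [CompleteSpace X] (h : IsPositiveHyperbolic J R) :
    ∃ T : X ≃L[ℝ] plusSpace R, ∀ x y, omega (J (T x)) (T y) = ⟪x, y⟫_ℝ := by
  obtain ⟨c, hc, hx⟩ := h.exists_coercive
  let ι : plusSpace R →L[ℝ] Dbl X := (plusSpace R).subtypeL
  let g : plusSpace R →L[ℝ] plusSpace R →L[ℝ] ℝ :=
    ((innerSL ℝ).bilinearComp (J ∘L ι) (Omega ∘L ι) : _)
  have hg : ∀ x y : plusSpace R, g x y = omega (J x) y := fun x y => rfl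
  exact exists_equiv_of_coercive g (fun x y => by rw [hg, hg, h.omega_symm]) hc
    (fun x => hx x) ((WithLp.prodContinuousLinearEquiv 2 ℝ X X).symm.trans h.doubleEquiv)

end IsPositiveHyperbolic

end Hyperbolic

/-! ### The Schwarzian as the coefficient of a second-order equation -/

section SchwarzianAlgebra

theorem hasDerivAt_ringInverse {A : Type*} [NormedRing A] [NormedAlgebra ℝ A] [CompleteSpace A]
    {f : ℝ → A} {f' : A} {u : ℝ} (hf : HasDerivAt f f' u) (hu : IsUnit (f u)) :
    HasDerivAt (fun t => Ring.inverse (f t))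
      (-(Ring.inverse (f u) * f' * Ring.inverse (f u))) u := by
  obtain ⟨x, hx⟩ := hu
  have h := (hasFDerivAt_ringInverse (𝕜 := ℝ) x)
  rw [hx] at h
  have := h.comp_hasDerivAt u hf
  refine this.congr_deriv ?_
  simp [← hx]

theorem hasDerivAt_iteratedDeriv {E : Type*} [NormedAddCommGroup E] [NormedSpace ℝ E]
    {V : Set ℝ} (hV : IsOpen V) {H : ℝ → E} (hH : ContDiffOn ℝ ∞ H V) (n : ℕ) {u : ℝ}
    (hu : u ∈ V) : HasDerivAt (iteratedDeriv n H) (iteratedDeriv (n + 1) H u) u := by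
  have : ∀ n : ℕ, ContDiffOn ℝ ∞ (iteratedDeriv n H) V := by
    intro n
    induction n with
    | zero => simpa using hH
    | succ n ih =>
      rw [iteratedDeriv_succ]
      exact ih.deriv_of_isOpen hV (by simp)
  rw [iteratedDeriv_succ]
  exact (((this n).contDiffAt (hV.mem_nhds hu)).differentiableAt (by simp)).hasDerivAt

theorem hasDerivAt_const_comp {E F G : Type*} [NormedAddCommGroup E] [NormedSpace ℝ E]
    [NormedAddCommGroup F] [NormedSpace ℝ F] [NormedAddCommGroup G] [NormedSpace ℝ G]
    (L : F →L[ℝ] G) {A : ℝ → E →L[ℝ] F} {A' : E →L[ℝ] F} {u : ℝ} (hA : HasDerivAt A A' u) :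
    HasDerivAt (fun t => L ∘L A t) (L ∘L A') u := by
  simpa using (hasDerivAt_const u L).clm_comp hA

variable {𝔸 : Type*} [NormedRing 𝔸] [NormedAlgebra ℝ 𝔸] [CompleteSpace 𝔸]

/-- If `A' = -(1/2) H'⁻¹ H'' A` and `A Y = H'⁻¹`, then `A'' = -A S / 2` and `(H A)'' = -H A S / 2`,
where `S` is the Schwarzian expression. -/
theorem hasDerivAt_schwarzian {V : Set ℝ} {H H₁ H₂ H₃ A Y S : ℝ → 𝔸}
    (hd1 : ∀ u ∈ V, HasDerivAt H (H₁ u) u) (hd2 : ∀ u ∈ V, HasDerivAt H₁ (H₂ u) u)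
    (hd3 : ∀ u ∈ V, HasDerivAt H₂ (H₃ u) u) (hH1 : ∀ u ∈ V, IsUnit (H₁ u))
    (hA : ∀ u ∈ V, HasDerivAt A (-(2⁻¹ : ℝ) • (Ring.inverse (H₁ u) * H₂ u * A u)) u)
    (hAY : ∀ u ∈ V, A u * Y u = Ring.inverse (H₁ u))
    (hS : ∀ u ∈ V, S u = (2⁻¹ : ℝ) • (Y u * ((2 : ℝ) • H₃ u -
      (3 : ℝ) • (H₂ u * Ring.inverse (H₁ u) * H₂ u)) * A u)) :
    ∃ A₁ : ℝ → 𝔸, ∀ u ∈ V, HasDerivAt A (A₁ u) u ∧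
      HasDerivAt A₁ (-(A u * ((2⁻¹ : ℝ) • S u))) u ∧
      HasDerivAt (fun t => H t * A t) (H₁ u * A u + H u * A₁ u) u ∧
      HasDerivAt (fun t => H₁ t * A t + H t * A₁ t) (-(H u * A u * ((2⁻¹ : ℝ) • S u))) u := by
  let Z : ℝ → 𝔸 := fun u => Ring.inverse (H₁ u)
  let A₁ : ℝ → 𝔸 := fun u => -(2⁻¹ : ℝ) • (Z u * H₂ u * A u)
  have hZ : ∀ u ∈ V, HasDerivAt Z (-(Z u * H₂ u * Z u)) u := fun u hu =>
    hasDerivAt_ringInverse (hd2 u hu) (hH1 u hu)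
  -- A Y = H'⁻¹ eliminates Y, leaving an expression to compare with A''.
  have hAq : ∀ u ∈ V, A u * ((2⁻¹ : ℝ) • S u) =
      (4⁻¹ : ℝ) • (Z u * ((2 : ℝ) • H₃ u - (3 : ℝ) • (H₂ u * Z u * H₂ u)) * A u) := by
    intro u hu
    rw [hS u hu, smul_smul, mul_smul_comm, ← mul_assoc, ← mul_assoc, hAY u hu]
    norm_num
    rfl
  have hA1 : ∀ u ∈ V, HasDerivAt A₁ (-(A u * ((2⁻¹ : ℝ) • S u))) u := by
    intro u hu
    refine ((((hZ u hu).mul (hd3 u hu)).mul (hA u hu)).const_smul (-(2⁻¹ : ℝ))).congr_deriv ?_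
    rw [hAq u hu]
    simp only [Z, mul_sub, sub_mul, add_mul, smul_mul_assoc, mul_smul_comm, mul_assoc, neg_mul,
      Pi.mul_apply]
    module
  refine ⟨A₁, fun u hu => ⟨hA u hu, hA1 u hu, (hd1 u hu).mul (hA u hu), ?_⟩⟩
  refine (((hd2 u hu).mul (hA u hu)).add ((hd1 u hu).mul (hA1 u hu))).congr_deriv ?_
  -- The gauge equation says H'' A + 2 H' A' = 0, so (H A)'' reduces to H A''.
  have e : H₁ u * A₁ u = -(2⁻¹ : ℝ) • (H₂ u * A u) := by
    simp only [A₁, Z, mul_smul_comm]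
    rw [← mul_assoc, ← mul_assoc, Ring.mul_inverse_cancel _ (hH1 u hu), one_mul]
  rw [e]
  simp only [mul_neg, mul_assoc]
  module

omit [NormedAlgebra ℝ 𝔸] [CompleteSpace 𝔸] in
theorem mul_mul_eq_one_of_mul_eq_inverse {A Y H₁ : 𝔸} (hA : IsUnit A) (hH : IsUnit H₁)
    (h : A * Y = Ring.inverse H₁) : Y * H₁ * A = 1 := by
  obtain ⟨x, rfl⟩ := hA
  have : Y * H₁ = ↑x⁻¹ := by
    rw [← Units.inv_mul_cancel_left x Y, h, mul_assoc, Ring.inverse_mul_cancel _ hH, mul_one]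
  rw [this, Units.inv_mul]

end SchwarzianAlgebra

/-! ### From a Lagrange–Schwarzian to a normal frame -/

section GraphFrame

variable {X : Type*} [NormedAddCommGroup X] [InnerProductSpace ℝ X]
  {E : Type*} [NormedAddCommGroup E] [NormedSpace ℝ E]

/-- A curve of Lagrangian subspaces given as the ranges of `a ↦ i (A a) + j (B a)`, where
`A'' = -A q` and `B'' = -B q`, has a normal frame. -/
theorem isNormalFrame_graph {i j : E →L[ℝ] Dbl X} {g : E → E → ℝ}
    (hij : ∀ a b c d, omega (i a + j b) (i c + j d) = g b c - g a d)
    {V : Set ℝ} {K : ℝ → Submodule ℝ (Dbl X)} {A B A₁ B₁ q : ℝ → E →L[ℝ] E}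
    (hA : ∀ u ∈ V, HasDerivAt A (A₁ u) u) (hA1 : ∀ u ∈ V, HasDerivAt A₁ (-(A u * q u)) u)
    (hB : ∀ u ∈ V, HasDerivAt B (B₁ u) u) (hB1 : ∀ u ∈ V, HasDerivAt B₁ (-(B u * q u)) u)
    (hr : ∀ u ∈ V, ∀ z, z ∈ K u ↔ ∃ a, i (A u a) + j (B u a) = z)
    (hg : ∀ u ∈ V, ∀ a b, g (A u a) (B₁ u b) - g (B u a) (A₁ u b) = g a b) :
    IsNormalFrame V K g q (fun u => i ∘L A u + j ∘L B u) (fun u => i ∘L A₁ u + j ∘L B₁ u) where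
  hasDerivAt u hu := (hasDerivAt_const_comp i (hA u hu)).add (hasDerivAt_const_comp j (hB u hu))
  hasDerivAt' u hu := by
    refine ((hasDerivAt_const_comp i (hA1 u hu)).add
      (hasDerivAt_const_comp j (hB1 u hu))).congr_deriv ?_
    ext1 a
    change i (-A u (q u a)) + j (-B u (q u a)) = -(i (A u (q u a)) + j (B u (q u a)))
    rw [map_neg, map_neg, neg_add]
  range := hr
  pairing u hu a b := by
    rw [← hg u hu a b, neg_sub]
    exact hij _ _ _ _

/-- The frame of a curve of graphs of `H`, in the gauge `A`. -/
theorem exists_isNormalFrame_of_schwarzian [CompleteSpace E] {i j : E →L[ℝ] Dbl X}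
    {g : E → E → ℝ} (hij : ∀ a b c d, omega (i a + j b) (i c + j d) = g b c - g a d)
    (hadd : ∀ a b c, g a (b + c) = g a b + g a c)
    {V : Set ℝ} (hV : IsOpen V) {K : ℝ → Submodule ℝ (Dbl X)} (hK : ∀ u ∈ V, IsLagrangian (K u))
    {H A Y S : ℝ → E →L[ℝ] E} (hH : ContDiffOn ℝ ∞ H V)
    (hgr : ∀ u ∈ V, ∀ z, z ∈ K u ↔ ∃ a, z = i a + j (H u a))
    (hH1 : ∀ u ∈ V, IsUnit (deriv H u)) (hAu : ∀ u ∈ V, IsUnit (A u))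
    (hY : ∀ u ∈ V, ∀ a b, g (A u a) b = g a (Y u b))
    (hA : ∀ u ∈ V, HasDerivAt A
        (-(2⁻¹ : ℝ) • (Ring.inverse (deriv H u) * iteratedDeriv 2 H u * A u)) u)
    (hAY : ∀ u ∈ V, A u * Y u = Ring.inverse (deriv H u))
    (hS : ∀ u ∈ V, S u = (2⁻¹ : ℝ) • (Y u * ((2 : ℝ) • iteratedDeriv 3 H u -
      (3 : ℝ) • (iteratedDeriv 2 H u * Ring.inverse (deriv H u) * iteratedDeriv 2 H u)) * A u)) :
    ∃ W W', IsNormalFrame V K g (fun u => (2⁻¹ : ℝ) • S u) W W' := by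
  have hd1 : ∀ u ∈ V, HasDerivAt H (deriv H u) u := fun u hu => by
    have := hasDerivAt_iteratedDeriv hV hH 0 hu
    rwa [iteratedDeriv_zero, iteratedDeriv_one] at this
  have hd2 : ∀ u ∈ V, HasDerivAt (deriv H) (iteratedDeriv 2 H u) u := fun u hu => by
    have := hasDerivAt_iteratedDeriv hV hH 1 hu
    rwa [iteratedDeriv_one] at this
  obtain ⟨A₁, hA₁⟩ := hasDerivAt_schwarzian hd1 hd2
    (fun u hu => hasDerivAt_iteratedDeriv hV hH 2 hu) hH1 hA hAY hS
  refine ⟨_, _, isNormalFrame_graph hij (fun u hu => (hA₁ u hu).1) (fun u hu => (hA₁ u hu).2.1)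
    (fun u hu => (hA₁ u hu).2.2.1) (fun u hu => (hA₁ u hu).2.2.2) ?_ ?_⟩
  · intro u hu z
    rw [hgr u hu z]
    have hs := (ContinuousLinearMap.isUnit_iff_bijective.1 (hAu u hu)).2
    constructor
    · rintro ⟨a, rfl⟩
      obtain ⟨b, rfl⟩ := hs a
      exact ⟨b, rfl⟩
    · rintro ⟨b, rfl⟩
      exact ⟨A u b, rfl⟩
  · intro u hu a b
    -- Symmetry of H cancels the terms with A₁ in the pairing, which leaves A* H' A = 1.
    have hsym : ∀ a b, g (H u a) b = g a (H u b) := by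
      intro a b
      have := (hK u hu).omega_eq_zero ((hgr u hu _).2 ⟨a, rfl⟩) ((hgr u hu _).2 ⟨b, rfl⟩)
      rw [hij] at this
      linarith
    have e1 := mul_mul_eq_one_of_mul_eq_inverse (hAu u hu) (hH1 u hu) (hAY u hu)
    have e2 : g (A u a) (deriv H u (A u b)) = g a b := by
      rw [hY u hu]
      exact congrArg (fun N : E →L[ℝ] E => g a (N b)) e1
    change g (A u a) (deriv H u (A u b) + H u (A₁ u b)) - g (H u (A u a)) (A₁ u b) = g a b
    rw [hadd, e2, hsym]
    ring

end GraphFrame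

/-! ### Recovering the gauge equation from a frame -/

section ExistenceAlgebra

variable {𝔸 : Type*} [NormedRing 𝔸] [NormedAlgebra ℝ 𝔸] [CompleteSpace 𝔸]

theorem contDiffOn_ringInverse {A : ℝ → 𝔸} {V : Set ℝ} (hA : ContDiffOn ℝ ∞ A V)
    (hu : ∀ u ∈ V, IsUnit (A u)) : ContDiffOn ℝ ∞ (fun u => Ring.inverse (A u)) V := by
  intro u huV
  obtain ⟨x, hx⟩ := hu u huV
  have h := contDiffAt_ringInverse ℝ (n := ∞) x
  rw [hx] at h
  exact h.comp_contDiffWithinAt u (hA u huV)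

omit [CompleteSpace 𝔸] in
/-- If `A'' = -A q` and `(H A)'' = -H A q` with `A`, `H'` invertible, then
`A' = -(1/2) H'⁻¹ H'' A`. -/
theorem deriv_gauge {V : Set ℝ} (hV : IsOpen V) {H A A₁ B B₁ q : ℝ → 𝔸}
    (hH : ContDiffOn ℝ ∞ H V)
    (hA : ∀ u ∈ V, HasDerivAt A (A₁ u) u) (hA1 : ∀ u ∈ V, HasDerivAt A₁ (-(A u * q u)) u)
    (hB : ∀ u ∈ V, HasDerivAt B (B₁ u) u) (hB1 : ∀ u ∈ V, HasDerivAt B₁ (-(B u * q u)) u)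
    (hBA : ∀ u ∈ V, B u = H u * A u) :
    ∀ u ∈ V, B₁ u = deriv H u * A u + H u * A₁ u ∧
      (IsUnit (deriv H u) →
        A₁ u = -(2⁻¹ : ℝ) • (Ring.inverse (deriv H u) * iteratedDeriv 2 H u * A u)) := by
  have hd1 : ∀ u ∈ V, HasDerivAt H (deriv H u) u := fun u hu => by
    have := hasDerivAt_iteratedDeriv hV hH 0 hu
    rwa [iteratedDeriv_zero, iteratedDeriv_one] at this
  have hd2 : ∀ u ∈ V, HasDerivAt (deriv H) (iteratedDeriv 2 H u) u := fun u hu => by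
    have := hasDerivAt_iteratedDeriv hV hH 1 hu
    rwa [iteratedDeriv_one] at this
  have e1 : ∀ u ∈ V, B₁ u = deriv H u * A u + H u * A₁ u := fun u hu =>
    ((hB u hu).congr_of_eventuallyEq (by
      filter_upwards [hV.mem_nhds hu] with t ht using (hBA t ht).symm)).unique
      ((hd1 u hu).mul (hA u hu))
  refine fun u hu => ⟨e1 u hu, fun hunit => ?_⟩
  -- Second derivatives of B = H A: since B'' = -B q = H A'', the rest, H'' A + 2 H' A', vanishes.
  have e2 := ((hB1 u hu).congr_of_eventuallyEq (by
      filter_upwards [hV.mem_nhds hu] with t ht using (e1 t ht).symm)).unique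
      (((hd2 u hu).mul (hA u hu)).add ((hd1 u hu).mul (hA1 u hu)))
  have e3 : (2 : ℝ) • (deriv H u * A₁ u) = -(iteratedDeriv 2 H u * A u) := by
    rw [hBA u hu, mul_neg, ← mul_assoc] at e2
    have e4 : iteratedDeriv 2 H u * A u + (2 : ℝ) • (deriv H u * A₁ u) = 0 := by
      rw [two_smul]
      rw [← sub_eq_zero.2 e2.symm]
      abel
    exact eq_neg_of_add_eq_zero_right e4
  have e5 : deriv H u * A₁ u = -(2⁻¹ : ℝ) • (iteratedDeriv 2 H u * A u) := by
    rw [neg_smul, ← smul_neg, ← e3, smul_smul]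
    norm_num
  rw [← Ring.inverse_mul_cancel_left _ (A₁ u) hunit, e5, mul_smul_comm, mul_assoc]

-- The relation gives Y H₁ = A⁻¹, so A Y is a left inverse of H₁; the left inverse of Y makes it
-- two-sided.
omit [NormedAlgebra ℝ 𝔸] [CompleteSpace 𝔸] in
theorem isUnit_and_mul_eq_inverse {A Y Y' H₁ : 𝔸} (hA : IsUnit A) (hY : Y' * Y = 1)
    (h : Y * H₁ * A = 1) : IsUnit H₁ ∧ A * Y = Ring.inverse H₁ := by
  obtain ⟨x, rfl⟩ := hA
  have h1 : Y * H₁ = ↑x⁻¹ := by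
    rw [← Units.mul_inv_cancel_right (Y * H₁) x, h, one_mul]
  have h2 : H₁ = Y' * ↑x⁻¹ := by rw [← h1, ← mul_assoc, hY, one_mul]
  let y : 𝔸ˣ := ⟨H₁, x * Y, by rw [h2, mul_assoc, Units.inv_mul_cancel_left, hY],
    by rw [mul_assoc, h1, Units.mul_inv]⟩
  exact ⟨⟨y, rfl⟩, (Ring.inverse_unit y).symm⟩

end ExistenceAlgebra

/-! ### From a normal frame to a Lagrange–Schwarzian -/

section Existence

variable {X : Type*} [NormedAddCommGroup X] [InnerProductSpace ℝ X] [CompleteSpace X]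
  {E : Type*} [NormedAddCommGroup E] [NormedSpace ℝ E] [CompleteSpace E]

/-- The adjoint for the inner product transported from `X` to `E`. -/
def transportAdjoint (T : X ≃L[ℝ] E) (M : E →L[ℝ] E) : E →L[ℝ] E :=
  (T : X →L[ℝ] E) ∘L ((T.symm : E →L[ℝ] X) ∘L M ∘L (T : X →L[ℝ] E)).adjoint ∘L
    (T.symm : E →L[ℝ] X)

omit [CompleteSpace X] [CompleteSpace E] in
theorem form_eq_inner {T : X ≃L[ℝ] E} {g : E → E → ℝ} (hT : ∀ x y, g (T x) (T y) = ⟪x, y⟫_ℝ)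
    (a b : E) : g a b = ⟪T.symm a, T.symm b⟫_ℝ := by
  rw [← hT, T.apply_symm_apply, T.apply_symm_apply]

omit [CompleteSpace E] in
theorem transportAdjoint_spec {T : X ≃L[ℝ] E} {g : E → E → ℝ}
    (hT : ∀ x y, g (T x) (T y) = ⟪x, y⟫_ℝ) (M : E →L[ℝ] E) (a b : E) :
    g (M a) b = g a (transportAdjoint T M b) := by
  rw [form_eq_inner hT, form_eq_inner hT, transportAdjoint]
  simp only [ContinuousLinearMap.coe_comp, Function.comp_apply, ContinuousLinearEquiv.coe_coe,
    ContinuousLinearEquiv.symm_apply_apply, ContinuousLinearMap.adjoint_inner_right,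
    ContinuousLinearEquiv.apply_symm_apply]

omit [CompleteSpace X] [CompleteSpace E] in
theorem eq_of_form_eq {T : X ≃L[ℝ] E} {g : E → E → ℝ}
    (hT : ∀ x y, g (T x) (T y) = ⟪x, y⟫_ℝ) {a b : E} (h : ∀ c, g c a = g c b) : a = b := by
  refine T.symm.injective (ext_inner_left ℝ fun x => ?_)
  have := h (T x)
  rwa [form_eq_inner hT, form_eq_inner hT, T.symm_apply_apply] at this

/-- A normal frame of a curve complementary to a fixed subspace provides the operators in a
Lagrange-Schwarzian. -/
theorem exists_schwarzian_gauge {T : X ≃L[ℝ] E} {g : E → E → ℝ}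
    (hT : ∀ x y, g (T x) (T y) = ⟪x, y⟫_ℝ) {i j : E →L[ℝ] Dbl X} {π ρ : Dbl X →L[ℝ] E}
    (hij : ∀ a b c d, omega (i a + j b) (i c + j d) = g b c - g a d)
    (hπρ : ∀ z, i (π z) + j (ρ z) = z) (hπ : ∀ a, π (i a) = a)
    {N : Submodule ℝ (Dbl X)} (hN : ∀ z, π z = 0 ↔ z ∈ N)
    {V : Set ℝ} (hV : IsOpen V) {K : ℝ → Submodule ℝ (Dbl X)} (hK : ∀ u ∈ V, IsLagrangian (K u))
    (hc : ∀ u ∈ V, IsCompl (K u) N) {W W' : ℝ → E →L[ℝ] Dbl X} {q : ℝ → E →L[ℝ] E}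
    (h : IsNormalFrame V K g q W W') (hW : ContDiffOn ℝ ∞ W V) :
    ∃ H A Y : ℝ → E →L[ℝ] E, ContDiffOn ℝ ∞ H V ∧ ∀ u ∈ V,
      (∀ z, z ∈ K u ↔ ∃ a, z = i a + j (H u a)) ∧
      IsUnit (deriv H u) ∧ IsUnit (A u) ∧ (∀ a b, g (A u a) b = g a (Y u b)) ∧
      HasDerivAt A
        (-(2⁻¹ : ℝ) • (Ring.inverse (deriv H u) * iteratedDeriv 2 H u * A u)) u ∧
      A u * Y u = Ring.inverse (deriv H u) := by
  let A : ℝ → E →L[ℝ] E := fun u => π ∘L W u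
  let A₁ : ℝ → E →L[ℝ] E := fun u => π ∘L W' u
  let B : ℝ → E →L[ℝ] E := fun u => ρ ∘L W u
  let B₁ : ℝ → E →L[ℝ] E := fun u => ρ ∘L W' u
  let H : ℝ → E →L[ℝ] E := fun u => B u * Ring.inverse (A u)
  have hWinj : ∀ u ∈ V, ∀ a, W u a = 0 → a = 0 := by
    intro u hu a ha
    refine eq_of_form_eq hT fun c => ?_
    rw [form_eq_inner hT c 0, map_zero, inner_zero_right, form_eq_inner hT, real_inner_comm,
      ← form_eq_inner hT, ← neg_eq_zero, ← h.pairing u hu, ha, omega_zero_left]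
  have hWAB : ∀ u a, i (A u a) + j (B u a) = W u a := fun u a => hπρ _
  -- N is the kernel of π. Trivial intersection with K u gives injectivity, and spanning gives
  -- surjectivity.
  have hAu : ∀ u ∈ V, IsUnit (A u) := by
    intro u hu
    rw [ContinuousLinearMap.isUnit_iff_bijective]
    constructor
    · rw [injective_iff_map_eq_zero]
      intro a ha
      refine hWinj u hu a ?_
      have : W u a ∈ K u ⊓ N := ⟨h.mem hu a, (hN _).1 ha⟩
      rwa [(hc u hu).inf_eq_bot, Submodule.mem_bot] at this
    · intro a
      have : i a ∈ K u ⊔ N := by rw [(hc u hu).sup_eq_top]; trivial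
      obtain ⟨k, hk, n, hn, hkn⟩ := Submodule.mem_sup.1 this
      obtain ⟨b, rfl⟩ := (h.range u hu k).1 hk
      refine ⟨b, ?_⟩
      have e := congrArg π hkn
      rwa [map_add, (hN n).2 hn, add_zero, hπ] at e
  have hAs : ContDiffOn ℝ ∞ A V := contDiffOn_const.clm_comp hW
  have hBs : ContDiffOn ℝ ∞ B V := contDiffOn_const.clm_comp hW
  have hH : ContDiffOn ℝ ∞ H V := hBs.mul (contDiffOn_ringInverse hAs hAu)
  have hBA : ∀ u ∈ V, B u = H u * A u := fun u hu =>
    (Ring.inverse_mul_cancel_right (A u) (B u) (hAu u hu)).symm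
  have hgr : ∀ u ∈ V, ∀ z, z ∈ K u ↔ ∃ a, z = i a + j (H u a) := by
    intro u hu z
    rw [h.range u hu z]
    constructor
    · rintro ⟨a, rfl⟩
      refine ⟨A u a, ?_⟩
      rw [← hWAB, hBA u hu]
      rfl
    · rintro ⟨b, rfl⟩
      obtain ⟨a, rfl⟩ := (ContinuousLinearMap.isUnit_iff_bijective.1 (hAu u hu)).2 b
      refine ⟨a, ?_⟩
      rw [← hWAB, hBA u hu]
      rfl
  have hsym : ∀ u ∈ V, ∀ a b, g (H u a) b = g a (H u b) := by
    intro u hu a b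
    have := (hK u hu).omega_eq_zero ((hgr u hu _).2 ⟨a, rfl⟩) ((hgr u hu _).2 ⟨b, rfl⟩)
    rw [hij] at this
    linarith
  have hA : ∀ u ∈ V, HasDerivAt A (A₁ u) u := fun u hu =>
    hasDerivAt_const_comp π (h.hasDerivAt u hu)
  have hB : ∀ u ∈ V, HasDerivAt B (B₁ u) u := fun u hu =>
    hasDerivAt_const_comp ρ (h.hasDerivAt u hu)
  have hA1 : ∀ u ∈ V, HasDerivAt A₁ (-(A u * q u)) u := fun u hu =>
    (hasDerivAt_const_comp π (h.hasDerivAt' u hu)).congr_deriv (by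
      ext1 a
      exact map_neg π _)
  have hB1 : ∀ u ∈ V, HasDerivAt B₁ (-(B u * q u)) u := fun u hu =>
    (hasDerivAt_const_comp ρ (h.hasDerivAt' u hu)).congr_deriv (by
      ext1 a
      exact map_neg ρ _)
  have hgauge := deriv_gauge hV hH hA hA1 hB hB1 hBA
  -- With H symmetric, the normalization of the frame reads A* H' A = 1, and A* is invertible along
  -- with A.
  have hunit : ∀ u ∈ V, IsUnit (deriv H u) ∧
      A u * transportAdjoint T (A u) = Ring.inverse (deriv H u) := by
    intro u hu
    refine isUnit_and_mul_eq_inverse (Y' := transportAdjoint T (Ring.inverse (A u))) (hAu u hu)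
      ?_ ?_
    · ext1 b
      refine eq_of_form_eq hT fun a => ?_
      change g a (transportAdjoint T _ (transportAdjoint T _ b)) = g a b
      rw [← transportAdjoint_spec hT, ← transportAdjoint_spec hT]
      exact congrArg (fun M : E →L[ℝ] E => g (M a) b) (Ring.mul_inverse_cancel _ (hAu u hu))
    · ext1 b
      refine eq_of_form_eq hT fun a => ?_
      change g a (transportAdjoint T (A u) (deriv H u (A u b))) = g a b
      have e := h.pairing u hu a b
      have e1 : W' u b = i (A₁ u b) + j (deriv H u (A u b) + H u (A₁ u b)) := by
        have e2 := congrArg (fun M : E →L[ℝ] E => M b) (hgauge u hu).1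
        change B₁ u b = deriv H u (A u b) + H u (A₁ u b) at e2
        rw [← e2]
        exact (hπρ _).symm
      have e3 : B u a = H u (A u a) := congrArg (fun M : E →L[ℝ] E => M a) (hBA u hu)
      have hadd : ∀ a b c, g a (b + c) = g a b + g a c := fun a b c => by
        simp only [form_eq_inner hT, map_add, inner_add_right]
      rw [← hWAB, e1, hij, hadd, e3, hsym u hu] at e
      rw [← transportAdjoint_spec hT]
      linarith
  refine ⟨H, A, fun u => transportAdjoint T (A u), hH, fun u hu => ⟨hgr u hu, (hunit u hu).1,
    hAu u hu, transportAdjoint_spec hT _, ?_, (hunit u hu).2⟩⟩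
  rw [← (hgauge u hu).2 (hunit u hu).1]
  exact hA u hu

omit [CompleteSpace X] [CompleteSpace E] in
/-- Transport of a normal frame by a linear isometry. -/
theorem IsNormalFrame.comp_symm {T : X ≃L[ℝ] E} {g : E → E → ℝ}
    (hT : ∀ x y, g (T x) (T y) = ⟪x, y⟫_ℝ) {V : Set ℝ} {K : ℝ → Submodule ℝ (Dbl X)}
    {W W' : ℝ → X →L[ℝ] Dbl X} {p : ℝ → X →L[ℝ] X}
    (h : IsNormalFrame V K (fun x y => ⟪x, y⟫_ℝ) p W W') :
    IsNormalFrame V K g (fun u => (T : X →L[ℝ] E) ∘L p u ∘L (T.symm : E →L[ℝ] X))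
      (fun u => W u ∘L (T.symm : E →L[ℝ] X)) (fun u => W' u ∘L (T.symm : E →L[ℝ] X)) where
  hasDerivAt u hu := by
    simpa using (h.hasDerivAt u hu).clm_comp (hasDerivAt_const u (T.symm : E →L[ℝ] X))
  hasDerivAt' u hu := by
    refine ((h.hasDerivAt' u hu).clm_comp
      (hasDerivAt_const u (T.symm : E →L[ℝ] X))).congr_deriv ?_
    ext a
    simp
  range u hu z := by
    rw [h.range u hu z]
    constructor
    · rintro ⟨x, rfl⟩
      exact ⟨T x, by simp⟩
    · rintro ⟨a, rfl⟩
      exact ⟨T.symm a, rfl⟩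
  pairing u hu a b := by
    rw [← T.apply_symm_apply a, ← T.apply_symm_apply b, hT]
    simpa using h.pairing u hu (T.symm a) (T.symm b)

omit [CompleteSpace X] [CompleteSpace E] in
theorem IsNormalFrame.mono {V V' : Set ℝ} (hV : V' ⊆ V) {K : ℝ → Submodule ℝ (Dbl X)}
    {g : E → E → ℝ} {W W' : ℝ → E →L[ℝ] Dbl X} {p : ℝ → E →L[ℝ] E}
    (h : IsNormalFrame V K g p W W') : IsNormalFrame V' K g p W W' :=
  ⟨fun u hu => h.1 u (hV hu), fun u hu => h.2 u (hV hu), fun u hu => h.3 u (hV hu),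
    fun u hu => h.4 u (hV hu)⟩

end Existence

/-! ### The potential is half the Schwarzian -/

section HalfSchwarzian

variable {X : Type*} [NormedAddCommGroup X] [InnerProductSpace ℝ X] [CompleteSpace X]

/-- The potential of a normal frame is half the Lagrange-Schwarzian. -/
theorem IsNormalFrame.isHalfSchwarzian {U : Opens ℝ} {K : ℝ → Submodule ℝ (Dbl X)}
    {p : ℝ → X →L[ℝ] X} {W W' : ℝ → X →L[ℝ] Dbl X} (hK : ∀ u ∈ U, IsLagrangian (K u))
    (hW : ContDiffOn ℝ ∞ W U) (h : IsNormalFrame U K (fun x y => ⟪x, y⟫_ℝ) p W W') :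
    IsHalfSchwarzian U K p := by
  intro J R hJR V hVU hVc hcompl
  obtain ⟨T, hT⟩ := hJR.exists_isometry
  have hT' : ∀ x y, (fun a b : plusSpace R => omega (J a) b) (T x) (T y) = ⟪x, y⟫_ℝ := hT
  have hKV : ∀ u ∈ V, IsLagrangian (K u) := fun u hu => hK u (hVU hu)
  have hV : IsNormalFrame V K (fun x y => ⟪x, y⟫_ℝ) p W W' := h.mono hVU
  let i : plusSpace R →L[ℝ] Dbl X := (plusSpace R).subtypeL
  have hij : ∀ a b c d : plusSpace R, omega (i a + (J ∘L i) b) (i c + (J ∘L i) d) =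
      (fun a b : plusSpace R => omega (J a) b) b c - (fun a b : plusSpace R => omega (J a) b) a d :=
    hJR.omega_graph
  constructor
  · obtain ⟨H, A, Y, hH, hall⟩ := exists_schwarzian_gauge hT' (i := i) (j := J ∘L i)
      (π := hJR.plusProj) (ρ := hJR.plusProj ∘L (-J)) hij hJR.plusProj_add
      (fun a => by
        have := hJR.plusProj_graph a 0
        rwa [Submodule.coe_zero, map_zero, add_zero] at this)
      hJR.plusProj_eq_zero_iff V.isOpen hKV hcompl (hV.comp_symm hT')
      ((hW.mono hVU).clm_comp contDiffOn_const)
    exact ⟨_, H, A, Y, hH, fun u hu => ⟨(hall u hu).1, (hall u hu).2.1, (hall u hu).2.2.1,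
      (hall u hu).2.2.2.1, (hall u hu).2.2.2.2.1, (hall u hu).2.2.2.2.2, rfl⟩⟩
  · rintro S ⟨H, A, Y, hH, hall⟩
    -- On empty V there is no point at which to compare frames, and any isometry serves.
    rcases (V : Set ℝ).eq_empty_or_nonempty with he | hne
    · refine ⟨T, hT, fun u hu => ?_⟩
      have : u ∈ (V : Set ℝ) := hu
      simp [he] at this
    obtain ⟨Z, Z', hZ⟩ := exists_isNormalFrame_of_schwarzian (i := i) (j := J ∘L i)
      (g := fun a b : plusSpace R => omega (J a) b) hij
      (fun a b c => omega_add_right _ _ _) V.isOpen hKV hH (fun u hu => (hall u hu).1)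
      (fun u hu => (hall u hu).2.1) (fun u hu => (hall u hu).2.2.1)
      (fun u hu => (hall u hu).2.2.2.1) (fun u hu => (hall u hu).2.2.2.2.1)
      (fun u hu => (hall u hu).2.2.2.2.2.1) (fun u hu => (hall u hu).2.2.2.2.2.2)
    exact hZ.exists_equiv V.isOpen hVc hne hKV (fun a ha => hJR.eq_zero_of_form_eq_zero a ha) hV

end HalfSchwarzian

/-! ### Parallel transport along projections -/

section ParallelTransport

variable {𝔸 : Type*} [NormedRing 𝔸] [NormedAlgebra ℝ 𝔸] [CompleteSpace 𝔸] [StarRing 𝔸]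
  [ContinuousStar 𝔸] [StarModule ℝ 𝔸]

/-- Parallel transport along a curve of projections. -/
theorem exists_parallel_transport {U : Set ℝ} (hU : IsOpen U) (hc : U.OrdConnected) {P : ℝ → 𝔸}
    (hP : ContDiffOn ℝ ∞ P U) (hproj : ∀ u ∈ U, IsStarProjection (P u)) {u₀ : ℝ} (hu₀ : u₀ ∈ U) :
    ∃ G : ℝ → 𝔸, ContDiffOn ℝ ∞ G U ∧ ∀ u ∈ U, star (G u) * G u = 1 ∧ G u * star (G u) = 1 ∧
      P u * G u = G u * P u₀ := by
  have hP1 : ContDiffOn ℝ ∞ (deriv P) U := hP.deriv_of_isOpen hU (by simp)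
  have hd : ∀ u ∈ U, HasDerivAt P (deriv P u) u := fun u hu =>
    ((hP.contDiffAt (hU.mem_nhds hu)).differentiableAt (by simp)).hasDerivAt
  generalize deriv P = P₁ at *
  have hidem : ∀ u ∈ U, P u * P u = P u := fun u hu => (hproj u hu).isIdempotentElem
  have hsa : ∀ u ∈ U, star (P u) = P u := fun u hu => (hproj u hu).isSelfAdjoint
  have hsa1 : ∀ u ∈ U, star (P₁ u) = P₁ u := fun u hu =>
    ((hd u hu).star.congr_of_eventuallyEq (by
      filter_upwards [hU.mem_nhds hu] with t ht using (hsa t ht).symm)).unique (hd u hu)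
  have hid1 : ∀ u ∈ U, P₁ u = P₁ u * P u + P u * P₁ u := fun u hu =>
    (hd u hu).unique ((((hd u hu).mul (hd u hu))).congr_of_eventuallyEq (by
      filter_upwards [hU.mem_nhds hu] with t ht using (hidem t ht).symm))
  have hPPP : ∀ u ∈ U, P u * P₁ u * P u = 0 := by
    intro u hu
    have h := congrArg (fun x => P u * x * P u) (hid1 u hu)
    have e : P u * (P₁ u * P u + P u * P₁ u) * P u =
        P u * P₁ u * (P u * P u) + (P u * P u) * P₁ u * P u := by noncomm_ring
    simp only [e, hidem u hu] at h
    exact left_eq_add.1 h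
  -- The commutator M = [P', P] is skew, so the flow is unitary. Moreover [M, P] = P' because P P' P
  -- = 0, so G⁻¹ P G is constant.
  let M : ℝ → 𝔸 := fun u => P₁ u * P u - P u * P₁ u
  have hM : ContDiffOn ℝ ∞ M U := (hP1.mul hP).sub (hP.mul hP1)
  obtain ⟨G, L, hG, -, hG0, h⟩ := exists_linear_flow hU hc hM hu₀ (1 : 𝔸ˣ)
  have hMs : ∀ u ∈ U, star (M u) = -M u := by
    intro u hu
    simp only [M, star_sub, star_mul, hsa u hu, hsa1 u hu, neg_sub]
  have hGG : ∀ u ∈ U, star (G u) * G u = 1 := by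
    intro u hu
    have := eq_of_hasDerivAt_zero hU hc (f := fun t => star (G t) * G t) (fun t ht => by
      refine ((h t ht).1.star.mul (h t ht).1).congr_deriv ?_
      rw [star_mul, hMs t ht]
      noncomm_ring) hu hu₀
    simpa [hG0] using this
  have hLs : ∀ u ∈ U, L u = star (G u) := by
    intro u hu
    rw [← one_mul (L u), ← hGG u hu, mul_assoc, (h u hu).2.2.2, mul_one]
  refine ⟨G, hG, fun u hu => ⟨hGG u hu, by rw [← hLs u hu, (h u hu).2.2.2], ?_⟩⟩
  have hconst : L u * P u * G u = P u₀ := by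
    have := eq_of_hasDerivAt_zero hU hc (f := fun t => L t * P t * G t) (fun t ht => by
      refine (((h t ht).2.1.mul (hd t ht)).mul (h t ht).1).congr_deriv ?_
      have e : (-(L t * M t) * P t + L t * P₁ t) * G t + L t * P t * (M t * G t) =
        L t * (P₁ t + (P t * P₁ t * P t + P t * P₁ t * P t -
          (P t * P t) * P₁ t - P₁ t * (P t * P t))) * G t := by
        simp only [M]
        noncomm_ring
      have e' : P₁ t + (P t * P₁ t * P t + P t * P₁ t * P t -
          (P t * P t) * P₁ t - P₁ t * (P t * P t)) = 0 := by
        rw [hPPP t ht, hidem t ht]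
        nth_rewrite 1 [hid1 t ht]
        abel
      exact e.trans (by rw [e', mul_zero, zero_mul])) hu hu₀
    simpa [hG0, hLs u₀ hu₀] using this
  rw [← hconst, ← mul_assoc, ← mul_assoc, (h u hu).2.2.2, one_mul]

theorem exists_parallel_transport_operator {H : Type*} [NormedAddCommGroup H]
    [InnerProductSpace ℝ H] [CompleteSpace H] {U : Set ℝ} (hU : IsOpen U) (hc : U.OrdConnected)
    {P : ℝ → H →L[ℝ] H} (hP : ContDiffOn ℝ ∞ P U) (hproj : ∀ u ∈ U, IsStarProjection (P u))
    {u₀ : ℝ} (hu₀ : u₀ ∈ U) :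
    ∃ G : ℝ → H →L[ℝ] H, ContDiffOn ℝ ∞ G U ∧ ∀ u ∈ U, (∀ x, (G u).adjoint (G u x) = x) ∧
      (∀ x, G u ((G u).adjoint x) = x) ∧ ∀ x, P u (G u x) = G u (P u₀ x) := by
  obtain ⟨G, hG, h⟩ := exists_parallel_transport hU hc hP hproj hu₀
  exact ⟨G, hG, fun u hu => ⟨DFunLike.congr_fun (h u hu).1, DFunLike.congr_fun (h u hu).2.1,
    DFunLike.congr_fun (h u hu).2.2⟩⟩

end ParallelTransport

/-! ### Isometric frames of Lagrangian curves -/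

section IsometricFrame

universe u

variable {X : Type u} [NormedAddCommGroup X] [InnerProductSpace ℝ X] [CompleteSpace X]

theorem projection_apply_eq_self {P : Dbl X →L[ℝ] Dbl X} (hP : IsStarProjection P) {x : Dbl X} :
    P x = x ↔ x ∈ P.range := by
  constructor
  · intro h
    exact ⟨x, h⟩
  · rintro ⟨y, rfl⟩
    exact congrArg (fun M : Dbl X →L[ℝ] Dbl X => M y) hP.isIdempotentElem

theorem projection_projection {P : Dbl X →L[ℝ] Dbl X} (hP : IsStarProjection P) (x : Dbl X) :
    P (P x) = P x :=
  (projection_apply_eq_self hP).2 ⟨x, rfl⟩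

theorem inner_projection {P : Dbl X →L[ℝ] Dbl X} (hP : IsStarProjection P) (x y : Dbl X) :
    ⟪P x, y⟫_ℝ = ⟪x, P y⟫_ℝ := by
  have h : P.adjoint = P := hP.isSelfAdjoint
  nth_rewrite 2 [← h]
  rw [ContinuousLinearMap.adjoint_inner_right]

/-- Isotropy means that Ω maps the subspace into its orthogonal complement, and maximality that it
maps the complement back. -/
theorem Omega_projection {P : Dbl X →L[ℝ] Dbl X} (hP : IsStarProjection P)
    (hL : IsLagrangian P.range) (x : Dbl X) : Omega (P x) + P (Omega x) = Omega x := by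
  have h1 : P (Omega (P x)) = 0 := by
    refine ext_inner_right ℝ fun y => ?_
    rw [inner_projection hP, inner_Omega_left,
      hL.omega_eq_zero (x := P x) (y := P y) ⟨x, rfl⟩ ⟨y, rfl⟩]
    simp
  have h2 : P (Omega (x - P x)) = Omega (x - P x) := by
    rw [projection_apply_eq_self hP]
    refine hL.mem_of_omega_eq_zero ?_
    intro y hy
    rw [omega_Omega_right, ← (projection_apply_eq_self hP).2 hy, inner_projection hP, map_sub,
      projection_projection hP, sub_self, inner_zero_right, neg_zero]
  rw [map_sub, map_sub, h1, sub_zero] at h2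
  rw [h2]
  abel

/-- `(Ω, 2P - 1)` is a positive hyperbolic structure if `P` is the projection onto a Lagrangian
subspace. -/
theorem isPositiveHyperbolic_projection {P : Dbl X →L[ℝ] Dbl X} (hP : IsStarProjection P)
    (hL : IsLagrangian P.range) :
    IsPositiveHyperbolic Omega ((2 : ℝ) • P - ContinuousLinearMap.id ℝ (Dbl X)) := by
  have hR : ∀ x, ((2 : ℝ) • P - ContinuousLinearMap.id ℝ (Dbl X)) x = (2 : ℝ) • P x - x :=
    fun x => rfl
  refine ⟨fun x y => ?_, fun x y => ?_, Omega_Omega, fun x => ?_, fun x => ?_, fun x hx => ?_⟩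
  · rw [omega_Omega_left, ← omega_eq_inner]
  · have h1 : omega (P x) y + omega x (P y) = omega x y := by
      rw [omega_eq_inner, omega_eq_inner, omega_eq_inner, inner_projection hP, ← inner_add_right,
        add_comm, Omega_projection hP hL]
    rw [hR, hR]
    have h2 : omega (P x) (P y) = 0 := hL.omega_eq_zero ⟨x, rfl⟩ ⟨y, rfl⟩
    simp only [omega_sub_left, omega_sub_right, omega_smul_left, omega_smul_right, h2]
    linarith
  · rw [hR, hR, map_sub, map_smul, projection_projection hP]
    module
  · have e : (2 : ℝ) • Omega (P x) - Omega x + ((2 : ℝ) • P (Omega x) - Omega x) =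
        (2 : ℝ) • (Omega (P x) + P (Omega x)) - (2 : ℝ) • Omega x := by module
    rw [hR, hR, map_sub, map_smul, e, Omega_projection hP hL, sub_self]
  · rw [omega_Omega_left]
    exact real_inner_self_pos.2 hx

/-- A smooth curve of Lagrangian subspaces has a smooth isometric frame. -/
theorem IsSmoothLagrangianCurve.exists_frame {U : Opens ℝ} (hc : (U : Set ℝ).OrdConnected)
    (hne : (U : Set ℝ).Nonempty) {K : ℝ → Submodule ℝ (Dbl X)}
    (hK : IsSmoothLagrangianCurve U K) :
    ∃ F : ℝ → X →L[ℝ] Dbl X, ContDiffOn ℝ ∞ F U ∧ ∀ u ∈ U,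
      (∀ z, z ∈ K u ↔ ∃ a, F u a = z) ∧ ∀ a b, ⟪F u a, F u b⟫_ℝ = ⟪a, b⟫_ℝ := by
  obtain ⟨hL, P, hP, hproj⟩ := hK
  obtain ⟨v, hv⟩ := hne
  obtain ⟨G, hG, hGP⟩ := exists_parallel_transport_operator U.isOpen hc hP (fun u hu => (hproj u hu).1) hv
  have hLv : IsLagrangian (P v).range := by rw [(hproj v hv).2]; exact hL v hv
  -- This structure has `+1` eigenspace K v, which is thereby isometric to X; G carries the
  -- identification along the curve.
  have hyp := isPositiveHyperbolic_projection (hproj v hv).1 hLv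
  obtain ⟨T, hT⟩ := hyp.exists_isometry
  let F₀ : X →L[ℝ] Dbl X := (plusSpace _).subtypeL ∘L T.toContinuousLinearMap
  have hF₀ : ∀ a b, ⟪F₀ a, F₀ b⟫_ℝ = ⟪a, b⟫_ℝ := fun a b => by
    rw [← hT, omega_Omega_left]
    rfl
  have hF₀r : ∀ z, P v z = z ↔ ∃ a, F₀ a = z := by
    intro z
    have : P v z = z ↔ z ∈ plusSpace ((2 : ℝ) • P v - ContinuousLinearMap.id ℝ (Dbl X)) := by
      change _ ↔ (2 : ℝ) • P v z - z = z
      constructor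
      · intro h
        rw [h]
        module
      · intro h
        have h2 : (2 : ℝ) • P v z = (2 : ℝ) • z := by rw [sub_eq_iff_eq_add.1 h, two_smul]
        exact smul_right_injective _ (two_ne_zero (α := ℝ)) h2
    rw [this]
    constructor
    · intro hz
      exact ⟨T.symm ⟨z, hz⟩, by simp [F₀]⟩
    · rintro ⟨a, rfl⟩
      exact (T a).2
  refine ⟨fun u => G u ∘L F₀, hG.clm_comp contDiffOn_const, fun u hu => ⟨fun z => ?_, fun a b => ?_⟩⟩
  · obtain ⟨e3, e2, e1⟩ := hGP u hu
    rw [← (hproj u hu).2, ← projection_apply_eq_self (hproj u hu).1]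
    constructor
    · intro hz
      have : P v ((G u).adjoint z) = (G u).adjoint z := by
        rw [← e3 (P v _), ← e1, e2, hz]
      obtain ⟨a, ha⟩ := (hF₀r _).1 this
      refine ⟨a, ?_⟩
      change G u (F₀ a) = z
      rw [ha, e2]
    · rintro ⟨a, rfl⟩
      change P u (G u (F₀ a)) = G u (F₀ a)
      rw [e1, (hF₀r _).2 ⟨a, rfl⟩]
  · have e3 := (hGP u hu).1
    change ⟪G u (F₀ a), G u (F₀ b)⟫_ℝ = _
    rw [← ContinuousLinearMap.adjoint_inner_right, e3, hF₀]

end IsometricFrame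

/-! ### The potential of a normalized frame -/

section Potential

variable {X : Type*} [NormedAddCommGroup X] [InnerProductSpace ℝ X] [CompleteSpace X]

/-- A smooth frame with `ω(W a, W' b) = -⟪a, b⟫` and `ω(W a, W'' b) = 0` is normal for a potential. -/
theorem exists_potential {U : Opens ℝ} {K : ℝ → Submodule ℝ (Dbl X)}
    (hK : ∀ u ∈ U, IsLagrangian (K u)) {W W' W'' : ℝ → X →L[ℝ] Dbl X}
    (hW' : ContDiffOn ℝ ∞ W' U) (hW'' : ContDiffOn ℝ ∞ W'' U)
    (hd : ∀ u ∈ U, HasDerivAt W (W' u) u) (hd' : ∀ u ∈ U, HasDerivAt W' (W'' u) u)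
    (hr : ∀ u ∈ U, ∀ z, z ∈ K u ↔ ∃ a, W u a = z)
    (h1 : ∀ u ∈ U, ∀ a b, omega (W u a) (W' u b) = -⟪a, b⟫_ℝ)
    (h2 : ∀ u ∈ U, ∀ a b, omega (W u a) (W'' u b) = 0) :
    ∃ p : ℝ → X →L[ℝ] X, IsPotential U p ∧
      IsNormalFrame U K (fun x y => ⟪x, y⟫_ℝ) p W W' := by
  obtain ⟨p, hpdef⟩ : ∃ p : ℝ → X →L[ℝ] X, p = fun u => formOperator Omega (W' u) (W'' u) :=
    ⟨_, rfl⟩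
  have hp : ContDiffOn ℝ ∞ p U := by
    rw [hpdef]
    exact contDiffOn_formOperator_Omega (A := W') (B := W'') hW' hW''
  have hframe : IsNormalFrame U K (fun x y => ⟪x, y⟫_ℝ) p W W' := by
    have e : ∀ u ∈ U, W'' u = -(W u ∘L p u) := by
      intro u hu
      ext1 b
      have hmem : W'' u b ∈ K u := (hK u hu).mem_of_omega_eq_zero fun y hy => by
        obtain ⟨a, rfl⟩ := (hr u hu y).1 hy
        exact h2 u hu a b
      obtain ⟨c, hc⟩ := (hr u hu _).1 hmem
      have hpc : p u b = -c := by
        refine ext_inner_left ℝ fun e => ?_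
        rw [hpdef, inner_formOperator_Omega, ← hc, omega_skew, h1 u hu, inner_neg_right,
          real_inner_comm, neg_neg]
      change W'' u b = -(W u (p u b))
      rw [hpc, map_neg, neg_neg, hc]
    exact { hasDerivAt := hd, hasDerivAt' := fun u hu => e u hu ▸ hd' u hu, range := hr,
            pairing := h1 }
  refine ⟨p, ⟨hp, fun u hu => ?_⟩, hframe⟩
  rw [ContinuousLinearMap.isSelfAdjoint_iff_isSymmetric]
  intro a b
  -- The derivative of ω(W' a, W' b) = 0 is the symmetry of p.
  have h0 := hasDerivAt_eq_zero_of_const U.isOpen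
    (fun t ht => hframe.omega_deriv_deriv U.isOpen hK ht a b) hu
    (hasDerivAt_omega (hframe.hasDerivAt_apply' hu a) (hframe.hasDerivAt_apply' hu b))
  rw [omega_neg_left, omega_neg_right, h1 u hu, omega_skew (W' u a), h1 u hu,
    real_inner_comm a] at h0
  change ⟪p u a, b⟫_ℝ = ⟪a, p u b⟫_ℝ
  linarith

end Potential

/-! ### The tangent covector and the tangent form -/

section TangentForm

variable {X : Type*} [NormedAddCommGroup X] [InnerProductSpace ℝ X]
  {K : ℝ → Submodule ℝ (Dbl X)} {u : ℝ} {N : Dbl X →L[ℝ] Dbl X}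

theorem tendsto_add_nhdsNE (u : ℝ) : Tendsto (fun s : ℝ => u + s) (𝓝[≠] 0) (𝓝 u) := by
  have : Tendsto (fun s : ℝ => u + s) (𝓝 0) (𝓝 (u + 0)) := tendsto_const_nhds.add tendsto_id
  rw [add_zero] at this
  exact this.mono_left nhdsWithin_le_nhds

theorem tendsto_clm_apply {E F ι : Type*} [NormedAddCommGroup E] [NormedSpace ℝ E]
    [NormedAddCommGroup F] [NormedSpace ℝ F] {l : Filter ι} {A : ι → E →L[ℝ] F} {x : ι → E}
    {A₀ : E →L[ℝ] F} {x₀ : E} (hA : Tendsto A l (𝓝 A₀)) (hx : Tendsto x l (𝓝 x₀)) :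
    Tendsto (fun i => A i (x i)) l (𝓝 (A₀ x₀)) :=
  ((isBoundedBilinearMap_apply (𝕜 := ℝ) (E := E) (F := F)).continuous.tendsto (A₀, x₀)).comp
    (hA.prodMk_nhds hx)

/-- The tangent covector vanishes on `K u`. -/
theorem HasTangentCovector.apply_eq_zero (h : HasTangentCovector K u N) {k : Dbl X}
    (hk : k ∈ K u) : N k = 0 := by
  obtain ⟨R, hR, hlim⟩ := h
  have h1 : Tendsto (fun s => (s • R s) k) (𝓝[≠] 0) (𝓝 (((2 : ℝ) • N) k)) :=
    tendsto_clm_apply hlim tendsto_const_nhds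
  have h2 : Tendsto (fun s : ℝ => -(s • k)) (𝓝[≠] 0) (𝓝 (-((0 : ℝ) • k))) :=
    ((tendsto_id.smul_const k).neg).mono_left nhdsWithin_le_nhds
  have h3 := tendsto_nhds_unique (h1.congr' (by
    filter_upwards [hR] with s hs
    rw [smul_apply, hs.right k hk, smul_neg])) h2
  rw [zero_smul, neg_zero, smul_apply, smul_eq_zero] at h3
  exact h3.resolve_left two_ne_zero

/-- The tangent covector inverts differentiation of sections of the curve. -/
theorem HasTangentCovector.apply_deriv (h : HasTangentCovector K u N) {f : ℝ → Dbl X}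
    {f' : Dbl X} (hf : ∀ᶠ t in 𝓝 u, f t ∈ K t) (hd : HasDerivAt f f' u) : N f' = f u := by
  obtain ⟨R, hR, hlim⟩ := h
  -- The reflection fixes f(u + s) and negates f(u), so s R(s) turns the difference quotient into
  -- f(u + s) + f(u).
  have h1 : Tendsto (fun s => (s • R s) (s⁻¹ • (f (u + s) - f u))) (𝓝[≠] 0)
      (𝓝 (((2 : ℝ) • N) f')) := tendsto_clm_apply hlim (hasDerivAt_iff_tendsto_slope_zero.1 hd)
  have h2 : Tendsto (fun s => f (u + s) + f u) (𝓝[≠] 0) (𝓝 (f u + f u)) :=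
    (hd.continuousAt.tendsto.comp (tendsto_add_nhdsNE u)).add_const _
  have h3 := tendsto_nhds_unique (h1.congr' (by
    filter_upwards [hR, (tendsto_add_nhdsNE u).eventually hf, self_mem_nhdsWithin]
      with s hs hfs (hs0 : s ≠ 0)
    rw [smul_apply, map_smul, smul_smul, mul_inv_cancel₀ hs0, one_smul,
      map_sub, hs.left _ hfs, hs.right _ hf.self_of_nhds, sub_neg_eq_add])) h2
  rw [smul_apply, ← two_smul ℝ (f u)] at h3
  exact smul_right_injective _ (two_ne_zero (α := ℝ)) h3

theorem IsReflection.apply_eq_neg {A B : Submodule ℝ (Dbl X)} {R R' : Dbl X →L[ℝ] Dbl X}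
    (h : IsReflection A B R) (h' : IsReflection B A R') (x : Dbl X) : R' x = -R x := by
  have hx : x ∈ A ⊔ B := by rw [h.isCompl.sup_eq_top]; trivial
  obtain ⟨a, ha, b, hb, rfl⟩ := Submodule.mem_sup.1 hx
  rw [map_add, map_add, h.left a ha, h.right b hb, h'.left b hb, h'.right a ha]
  abel

/-- Positivity refers to [K(u) K(u+s)] and the covector to [K(u+s) K(u)], its negative; hence the
sign. -/
theorem HasTangentCovector.omega_nonpos (h : HasTangentCovector K u N) {R' : ℝ → Dbl X →L[ℝ] Dbl X}
    (hR' : ∀ᶠ s in 𝓝[≠] (0 : ℝ), IsReflection (K u) (K (u + s)) (R' s)) {x : Dbl X} {l : ℝ}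
    (hl : 0 ≤ l) (hlim' : Tendsto (fun s : ℝ => omega (s • R' s x) x) (𝓝[≠] 0) (𝓝 l)) :
    omega (N x) x ≤ 0 := by
  obtain ⟨R, hR, hlim⟩ := h
  have h1 : Tendsto (fun s => (s • R s) x) (𝓝[≠] 0) (𝓝 (((2 : ℝ) • N) x)) :=
    tendsto_clm_apply hlim tendsto_const_nhds
  have h2 : Tendsto (fun s => -omega ((s • R s) x) x) (𝓝[≠] 0)
      (𝓝 (-omega (((2 : ℝ) • N) x) x)) := (h1.inner tendsto_const_nhds).neg
  have h3 := tendsto_nhds_unique (h2.congr' (by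
    filter_upwards [hR, hR'] with s hs hs'
    rw [hs.apply_eq_neg hs', smul_apply, smul_neg, omega_neg_left])) hlim'
  rw [smul_apply, omega_smul_left] at h3
  linarith

variable [CompleteSpace X]

/-- For an isometric frame `F` of a regular positive curve, the form `-ω(F a, F' b)` is symmetric,
positive and invertible. -/
theorem tangentForm_properties {U : Opens ℝ} (hK : ∀ t ∈ U, IsLagrangian (K t))
    {F F' : ℝ → X →L[ℝ] Dbl X} (hd : ∀ t ∈ U, HasDerivAt F (F' t) t)
    (hr : ∀ t ∈ U, ∀ z, z ∈ K t ↔ ∃ a, F t a = z)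
    (hiso : ∀ t ∈ U, ∀ a b, ⟪F t a, F t b⟫_ℝ = ⟪a, b⟫_ℝ)
    (hN : HasTangentCovector K u N) (hpos : IsPositiveCurve U K) (hu : u ∈ U) :
    (∀ a b, ⟪formOperator Omega (F u) (F' u) a, b⟫_ℝ =
      ⟪a, formOperator Omega (F u) (F' u) b⟫_ℝ) ∧
    (∀ a, 0 ≤ ⟪formOperator Omega (F u) (F' u) a, a⟫_ℝ) ∧
    ∃ B : X →L[ℝ] X, ∀ a, B (formOperator Omega (F u) (F' u) a) = a := by
  have hmem : ∀ t ∈ U, ∀ a, F t a ∈ K t := fun t ht a => (hr t ht _).2 ⟨a, rfl⟩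
  have hda : ∀ t ∈ U, ∀ a, HasDerivAt (fun s => F s a) (F' t a) t := fun t ht a => by
    simpa using (hd t ht).clm_apply (hasDerivAt_const t a)
  have hNd : ∀ a, N (F' u a) = F u a := fun a => hN.apply_deriv (by
    filter_upwards [U.isOpen.mem_nhds hu] with t ht using hmem t ht a) (hda u hu a)
  refine ⟨fun a b => ?_, fun a => ?_, -formOperator (N ∘L Omega) (F u) (F u), fun a => ?_⟩
  · have h0 := hasDerivAt_eq_zero_of_const U.isOpen
      (fun t ht => (hK t ht).omega_eq_zero (hmem t ht a) (hmem t ht b)) hu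
      (hasDerivAt_omega (hda u hu a) (hda u hu b))
    rw [real_inner_comm, inner_formOperator_Omega, inner_formOperator_Omega, omega_skew (F u b)]
    linarith
  · obtain ⟨R', hR', hl⟩ := hpos u hu
    obtain ⟨l, hl0, hlim⟩ := hl (F' u a)
    have := hN.omega_nonpos hR' hl0 hlim
    rw [hNd] at this
    rw [real_inner_comm, inner_formOperator_Omega]
    linarith
  · set d := formOperator Omega (F u) (F' u) a with hdef
    have hv : F' u a - Omega (F u d) ∈ K u := by
      refine (hK u hu).mem_of_omega_eq_zero fun y hy => ?_
      obtain ⟨b, rfl⟩ := (hr u hu y).1 hy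
      rw [omega_sub_right, omega_Omega_right, hiso u hu, hdef, inner_formOperator_Omega]
      ring
    have hNv := hN.apply_eq_zero hv
    rw [map_sub, hNd, sub_eq_zero] at hNv
    refine ext_inner_left ℝ fun e => ?_
    rw [neg_apply, inner_neg_right, inner_formOperator, neg_neg, ContinuousLinearMap.comp_apply,
      ← hNv, hiso u hu]

end TangentForm

/-! ### The normalizing gauge -/

section Normalization

variable {𝔸 : Type*} [NormedRing 𝔸] [NormedAlgebra ℝ 𝔸] [CompleteSpace 𝔸] [StarRing 𝔸]
  [ContinuousStar 𝔸] [StarModule ℝ 𝔸]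

/-- A gauge `C` with `2 D C' + E C = 0` and `C* D C = 1`. -/
theorem exists_normalizing_gauge {U : Set ℝ} (hU : IsOpen U) (hc : U.OrdConnected)
    {D E Q : ℝ → 𝔸} (hD : ContDiffOn ℝ ∞ D U) (hE : ContDiffOn ℝ ∞ E U)
    (hd : ∀ u ∈ U, HasDerivAt D (E u + Q u) u) (hQ : ∀ u ∈ U, star (Q u) = -Q u)
    (hsa : ∀ u ∈ U, star (D u) = D u) (hunit : ∀ u ∈ U, IsUnit (D u)) {u₀ : ℝ} (hu₀ : u₀ ∈ U)
    (c₀ : 𝔸ˣ) (h₀ : star (c₀ : 𝔸) * D u₀ * c₀ = 1) :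
    ∃ C C₁ : ℝ → 𝔸, ContDiffOn ℝ ∞ C U ∧ ContDiffOn ℝ ∞ C₁ U ∧ ∀ u ∈ U,
      HasDerivAt C (C₁ u) u ∧ IsUnit (C u) ∧ star (C u) * D u * C u = 1 ∧
      (2 : ℝ) • (D u * C₁ u) = -(E u * C u) := by
  let M : ℝ → 𝔸 := fun u => -(2⁻¹ : ℝ) • (Ring.inverse (D u) * E u)
  have hM : ContDiffOn ℝ ∞ M U := ((contDiffOn_ringInverse hD hunit).mul hE).const_smul (-(2⁻¹ : ℝ))
  obtain ⟨C, L, hC, -, hC0, h⟩ := exists_linear_flow hU hc hM hu₀ c₀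
  have hDM : ∀ u ∈ U, D u * M u = -(2⁻¹ : ℝ) • E u := by
    intro u hu
    simp only [M, mul_smul_comm]
    rw [Ring.mul_inverse_cancel_left _ _ (hunit u hu)]
  have hMD : ∀ u ∈ U, star (M u) * D u = -(2⁻¹ : ℝ) • star (E u) := by
    intro u hu
    have := congrArg star (hDM u hu)
    rw [star_mul, hsa u hu] at this
    rw [this, star_smul, star_trivial]
  -- D' is self-adjoint and Q is skew, so Q is minus the skew part of E. This makes M* D + D' + D M
  -- vanish, so C* D C is constant.
  have hQE : ∀ u ∈ U, Q u = (2⁻¹ : ℝ) • (star (E u) - E u) := by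
    intro u hu
    have e : star (E u) - Q u = E u + Q u := by
      have := ((hd u hu).star.congr_of_eventuallyEq (by
        filter_upwards [hU.mem_nhds hu] with t ht using (hsa t ht).symm)).unique (hd u hu)
      rwa [star_add, hQ u hu, ← sub_eq_add_neg] at this
    have e' : star (E u) - E u = (2 : ℝ) • Q u := by
      rw [two_smul]
      rw [sub_eq_iff_eq_add] at e
      rw [e]
      abel
    rw [e', smul_smul]
    norm_num
  refine ⟨C, fun u => M u * C u, hC, hM.mul hC, fun u hu => ⟨(h u hu).1,
    ⟨⟨C u, L u, (h u hu).2.2.2, (h u hu).2.2.1⟩, rfl⟩, ?_, ?_⟩⟩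
  · have := eq_of_hasDerivAt_zero hU hc (f := fun t => star (C t) * D t * C t) (fun t ht => by
      refine (((h t ht).1.star.mul (hd t ht)).mul (h t ht).1).congr_deriv ?_
      have e : (star (M t * C t) * D t + star (C t) * (E t + Q t)) * C t +
          star (C t) * D t * (M t * C t) =
          star (C t) * (star (M t) * D t + (E t + Q t) + D t * M t) * C t := by
        rw [star_mul]
        noncomm_ring
      have e' : star (M t) * D t + (E t + Q t) + D t * M t = 0 := by
        rw [hMD t ht, hDM t ht, hQE t ht]
        module
      exact e.trans (by rw [e', mul_zero, zero_mul])) hu hu₀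
    simpa [hC0, h₀] using this
  · rw [← mul_assoc, hDM u hu, smul_mul_assoc, smul_smul]
    norm_num

omit [CompleteSpace 𝔸] in
theorem star_mul_self_eq_one_iff {V : Type*} [NormedAddCommGroup V] [InnerProductSpace ℝ V]
    [CompleteSpace V] (C D : V →L[ℝ] V) :
    star C * D * C = 1 ↔ ∀ a b, ⟪C a, D (C b)⟫_ℝ = ⟪a, b⟫_ℝ := by
  have key : ∀ a b, ⟪a, (star C * D * C) b⟫_ℝ = ⟪C a, D (C b)⟫_ℝ := fun a b =>
    ContinuousLinearMap.adjoint_inner_right C a (D (C b))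
  constructor
  · intro h a b
    rw [← key, h]
    rfl
  · intro h
    refine ContinuousLinearMap.ext fun b => ext_inner_left ℝ fun a => ?_
    rw [key, h]
    rfl

/-- The derivatives of a frame in a new gauge. -/
theorem frame_comp_derivatives {E T : Type*} [NormedAddCommGroup E] [NormedSpace ℝ E]
    [NormedAddCommGroup T] [NormedSpace ℝ T] {U : Set ℝ} {F F₁ F₂ : ℝ → E →L[ℝ] T}
    {C C₁ C₂ : ℝ → E →L[ℝ] E} (hF : ContDiffOn ℝ ∞ F U) (hF₁ : ContDiffOn ℝ ∞ F₁ U)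
    (hF₂ : ContDiffOn ℝ ∞ F₂ U) (hC : ContDiffOn ℝ ∞ C U) (hC₁ : ContDiffOn ℝ ∞ C₁ U)
    (hC₂ : ContDiffOn ℝ ∞ C₂ U)
    (hd : ∀ u ∈ U, HasDerivAt F (F₁ u) u) (hd₁ : ∀ u ∈ U, HasDerivAt F₁ (F₂ u) u)
    (hc : ∀ u ∈ U, HasDerivAt C (C₁ u) u) (hc₁ : ∀ u ∈ U, HasDerivAt C₁ (C₂ u) u) :
    ∃ W W₁ W₂ : ℝ → E →L[ℝ] T, ContDiffOn ℝ ∞ W U ∧ ContDiffOn ℝ ∞ W₁ U ∧ ContDiffOn ℝ ∞ W₂ U ∧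
      (∀ u ∈ U, HasDerivAt W (W₁ u) u) ∧ (∀ u ∈ U, HasDerivAt W₁ (W₂ u) u) ∧
      (∀ u a, W u a = F u (C u a)) ∧ (∀ u a, W₁ u a = F₁ u (C u a) + F u (C₁ u a)) ∧
      ∀ u a, W₂ u a = F₂ u (C u a) + F₁ u (C₁ u a) + (F₁ u (C₁ u a) + F u (C₂ u a)) :=
  ⟨fun u => F u ∘L C u, fun u => F₁ u ∘L C u + F u ∘L C₁ u,
    fun u => F₂ u ∘L C u + F₁ u ∘L C₁ u + (F₁ u ∘L C₁ u + F u ∘L C₂ u),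
    hF.clm_comp hC, (hF₁.clm_comp hC).add (hF.clm_comp hC₁),
    ((hF₂.clm_comp hC).add (hF₁.clm_comp hC₁)).add ((hF₁.clm_comp hC₁).add (hF.clm_comp hC₂)),
    fun u hu => (hd u hu).clm_comp (hc u hu),
    fun u hu => ((hd₁ u hu).clm_comp (hc u hu)).add ((hd u hu).clm_comp (hc₁ u hu)),
    fun _ _ => rfl, fun _ _ => rfl, fun _ _ => rfl⟩

theorem hasDerivAt_deriv_of_contDiffOn {E : Type*} [NormedAddCommGroup E] [NormedSpace ℝ E]
    {U : Set ℝ} (hU : IsOpen U) {f : ℝ → E} (hf : ContDiffOn ℝ ∞ f U) :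
    ContDiffOn ℝ ∞ (deriv f) U ∧ ∀ u ∈ U, HasDerivAt f (deriv f u) u :=
  ⟨hf.deriv_of_isOpen hU (by simp), fun _ hu =>
    ((hf.contDiffAt (hU.mem_nhds hu)).differentiableAt (by simp)).hasDerivAt⟩

end Normalization

/-! ### Existence of the normal frame -/

section Main

universe u

variable {X : Type u} [NormedAddCommGroup X] [InnerProductSpace ℝ X] [CompleteSpace X]

/-- A regular positive curve has a normal frame. -/
theorem exists_isNormalFrame {U : Opens ℝ} (hc : (U : Set ℝ).OrdConnected)
    (hne : (U : Set ℝ).Nonempty) {K : ℝ → Submodule ℝ (Dbl X)} (hreg : IsRegularCurve U K)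
    (hpos : IsPositiveCurve U K) :
    ∃ (p : ℝ → X →L[ℝ] X) (W W' : ℝ → X →L[ℝ] Dbl X), IsPotential U p ∧ ContDiffOn ℝ ∞ W U ∧
      IsNormalFrame U K (fun x y => ⟪x, y⟫_ℝ) p W W' := by
  have hK : ∀ u ∈ U, IsLagrangian (K u) := hreg.1.1
  obtain ⟨F, hF, hframe⟩ := hreg.1.exists_frame hc hne
  obtain ⟨hF₁, hd⟩ := hasDerivAt_deriv_of_contDiffOn U.isOpen hF
  generalize deriv F = F₁ at hF₁ hd
  obtain ⟨hF₂, hd₁⟩ := hasDerivAt_deriv_of_contDiffOn U.isOpen hF₁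
  generalize deriv F₁ = F₂ at hF₂ hd₁
  have hr : ∀ t ∈ U, ∀ z, z ∈ K t ↔ ∃ a, F t a = z := fun t ht => (hframe t ht).1
  have hmem : ∀ t ∈ U, ∀ a, F t a ∈ K t := fun t ht a => (hr t ht _).2 ⟨a, rfl⟩
  have hiso : ∀ t ∈ U, ∀ a b, ⟪F t a, F t b⟫_ℝ = ⟪a, b⟫_ℝ := fun t ht => (hframe t ht).2
  obtain ⟨D, hDdef⟩ : ∃ D : ℝ → X →L[ℝ] X, D = fun t => formOperator Omega (F t) (F₁ t) := ⟨_, rfl⟩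
  obtain ⟨E, hEdef⟩ : ∃ E : ℝ → X →L[ℝ] X, E = fun t => formOperator Omega (F t) (F₂ t) := ⟨_, rfl⟩
  obtain ⟨Q, hQdef⟩ : ∃ Q : ℝ → X →L[ℝ] X, Q = fun t => formOperator Omega (F₁ t) (F₁ t) := ⟨_, rfl⟩
  have hDi : ∀ t a b, ⟪a, D t b⟫_ℝ = -omega (F t a) (F₁ t b) := fun t a b => by
    rw [hDdef, inner_formOperator_Omega]
  have hEi : ∀ t a b, ⟪a, E t b⟫_ℝ = -omega (F t a) (F₂ t b) := fun t a b => by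
    rw [hEdef, inner_formOperator_Omega]
  have hDs : ContDiffOn ℝ ∞ D U := by
    rw [hDdef]
    exact contDiffOn_formOperator_Omega (A := F) (B := F₁) hF hF₁
  have hEs : ContDiffOn ℝ ∞ E U := by
    rw [hEdef]
    exact contDiffOn_formOperator_Omega (A := F) (B := F₂) hF hF₂
  have hDd : ∀ t ∈ U, HasDerivAt D (E t + Q t) t := fun t ht => by
    rw [hDdef, hEdef, hQdef, add_comm]
    exact hasDerivAt_formOperator_Omega (A := F) (B := F₁) (hd t ht) (hd₁ t ht)
  have hQs : ∀ t ∈ U, star (Q t) = -Q t := fun t _ => by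
    rw [hQdef]
    exact adjoint_formOperator_Omega (F₁ t) (F₁ t)
  have hprop : ∀ t ∈ U, (∀ a b, ⟪D t a, b⟫_ℝ = ⟪a, D t b⟫_ℝ) ∧ (∀ a, 0 ≤ ⟪D t a, a⟫_ℝ) ∧
      ∃ B : X →L[ℝ] X, ∀ a, B (D t a) = a := fun t ht => by
    obtain ⟨N, hN⟩ := hreg.2 t ht
    rw [hDdef]
    exact tangentForm_properties hK hd hr hiso hN hpos ht
  have hsa : ∀ t ∈ U, star (D t) = D t := fun t ht =>
    ContinuousLinearMap.isSelfAdjoint_iff_isSymmetric.2 (hprop t ht).1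
  have hunit : ∀ t ∈ U, IsUnit (D t) := by
    intro t ht
    obtain ⟨B, hB⟩ := (hprop t ht).2.2
    have hBD : B * D t = 1 := ContinuousLinearMap.ext hB
    -- As D is self-adjoint, the adjoint of a left inverse is a right inverse.
    refine isUnit_iff_exists_and_exists.2 ⟨⟨star B, ?_⟩, B, hBD⟩
    have := congrArg star hBD
    rwa [star_mul, hsa t ht, star_one] at this
  obtain ⟨v, hv⟩ := id hne
  obtain ⟨hsym, hnn, B, hB⟩ := hprop v hv
  obtain ⟨c, hcpos, hcoer⟩ := exists_coercive_of_left_inverse hsym hnn hB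
  -- The initial value of the gauge is an isometry from X onto X with the equivalent inner product
  -- ⟨D v x, y⟩.
  obtain ⟨T, hT⟩ := exists_equiv_of_coercive (E := X) ((innerSL ℝ).comp (D v))
    (fun x y => by
      change ⟪D v x, y⟫_ℝ = ⟪D v y, x⟫_ℝ
      rw [hsym, real_inner_comm]) hcpos hcoer (ContinuousLinearEquiv.refl ℝ (X × X))
  let c₀ : (X →L[ℝ] X)ˣ := ContinuousLinearEquiv.toUnit T
  obtain ⟨C, C₁, hC, hC₁, hCprop⟩ := exists_normalizing_gauge U.isOpen hc hDs hEs hDd hQs hsa hunit hv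
    c₀ ((star_mul_self_eq_one_iff _ _).2 fun a b => by
      rw [← hsym]
      exact hT a b)
  obtain ⟨hC₂, hc₂⟩ := hasDerivAt_deriv_of_contDiffOn U.isOpen hC₁
  obtain ⟨W, W₁, W₂, hW, hW₁, hW₂, hWd, hWd₁, hWa, hW₁a, hW₂a⟩ :=
    frame_comp_derivatives hF hF₁ hF₂ hC hC₁ hC₂ hd hd₁ (fun t ht => (hCprop t ht).1) hc₂
  obtain ⟨p, hp, hnf⟩ := exists_potential hK hW₁ hW₂ hWd hWd₁
    (fun t ht z => by
      rw [hr t ht]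
      constructor
      · rintro ⟨a, rfl⟩
        obtain ⟨b, rfl⟩ := (ContinuousLinearMap.isUnit_iff_bijective.1 (hCprop t ht).2.1).2 a
        exact ⟨b, hWa t b⟩
      · rintro ⟨b, rfl⟩
        exact ⟨C t b, (hWa t b).symm⟩)
    (fun t ht a b => by
      rw [hWa, hW₁a, omega_add_right, (hK t ht).omega_eq_zero (hmem t ht _) (hmem t ht _),
        add_zero, ← (star_mul_self_eq_one_iff _ _).1 (hCprop t ht).2.2.1 a b, hDi, neg_neg])
    (fun t ht a b => by
      have e : (2 : ℝ) • D t (C₁ t b) = -E t (C t b) :=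
        congrArg (fun M : X →L[ℝ] X => M b) (hCprop t ht).2.2.2
      have e' := congrArg (fun x => ⟪C t a, x⟫_ℝ) e
      simp only [inner_smul_right, inner_neg_right, hDi, hEi] at e'
      rw [hWa, hW₂a, omega_add_right, omega_add_right, omega_add_right,
        (hK t ht).omega_eq_zero (hmem t ht _) (hmem t ht _)]
      linarith)
  exact ⟨p, W, W₁, hp, hW, hnf⟩

end Main

end LagrangianCurves

end

open LagrangianCurves in
theorem mainTheorem10 {X : Type*} [NormedAddCommGroup X] [InnerProductSpace ℝ X] [CompleteSpace X]
    (U : TopologicalSpace.Opens ℝ) (hU : (U : Set ℝ).OrdConnected) (hne : (U : Set ℝ).Nonempty)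
    (K : ℝ → Submodule ℝ (Dbl X)) (hreg : IsRegularCurve U K) (hpos : IsPositiveCurve U K) :
    ∃ p : ℝ → X →L[ℝ] X, IsPotential U p ∧ IsHalfSchwarzian U K p ∧
      ∃ φ : solutionSpace U p ≃ₗ[ℝ] Dbl X, IsCanonicalTransformation φ ∧
        ∀ u ∈ U, (hamiltonianCurve U p u).map φ.toLinearMap = K u := by
  obtain ⟨p, W, W', hp, hW, h⟩ := exists_isNormalFrame hU hne hreg hpos
  exact ⟨p, hp, h.isHalfSchwarzian hreg.1.1 hW,
    h.exists_canonicalTransformation hU hne hp hreg.1.1 hW⟩
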